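/- **Setting.** Let $d\in\{2,3\}$ and let $\Omega\subset\mathbb R^d$ be a bounded polygonal (polyhedral) domain. $(\cdot,\cdot)$ and $\langle\cdot,\cdot\rangle$ are the inner products of $L^2(\Omega)$ and $L^2(\partial\Omega)$, and $\|\cdot\|$ is the norm of $L^2(\Omega)$. Let $\mu>0$, $\lambda+\mu>0$, and let $a_0,b_0,c_0,\alpha,\beta\ge 0$ be constants with $c_0>b_0$ and $a_0>b_0$. Put $$\mathcal M=c_0\beta^2+2\alpha\beta b_0+a_0\alpha^2+(c_0a_0-b_0^2)(\lambda+\mu),$$ $$\gamma_1=\tfrac{\beta c_0+\alpha b_0}{\mathcal M},\ \gamma_2=\tfrac{b_0(\lambda+\mu)-\alpha\beta}{\mathcal M},\ \gamma_3=\tfrac{\alpha^2+c_0(\lambda+\mu)}{\mathcal M},\ \gamma_4=\tfrac{a_0\alpha+\beta b_0}{\mathcal M},\ \gamma_5=\tfrac{a_0(\lambda+\mu)+\beta^2}{\mathcal M},\ \gamma_6=\tfrac{c_0a_0-b_0^2}{\mathcal M}.$$ Let $k:\mathbb R\to\mathbb R$ be continuous with $0<k_m<k<k_M$, and let $\boldsymbol\Theta:\mathbb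 R^d\to\mathbb R^{d\times d}$ be measurable and symmetric with $\theta_m|\zeta|^2\le\zeta^\top\boldsymbol\Theta(x)\zeta\le\theta_M|\zeta|^2$ for all $x,\zeta$, where $\theta_m>0$. The data are $\mathbf u_0\in\mathbf H^1(\Omega)$, $p_0,T_0,g,\phi\in L^2(\Omega)$, $\mathbf f\in\mathbf L^2(\Omega)$, $\mathbf f_1\in\mathbf L^2(\partial\Omega)$, $g_1,\phi_1\in L^2(\partial\Omega)$. **Discretization.** Let $\mathcal T_h$ be a conforming triangulation or rectangular partition of $\Omega$ with maximum mesh size $h$, quasi-uniform with constant $\rho>0$: each element contains a ball of radius $\rho h$. Let $M_h$ be the space of continuous functions on $\overline\Omega$ that are polynomials of degree at most $j$ on every element. Let $\mathbf V_h$ be the space of continuous vector fields that are polynomials of degree at most $i$ on every element and are $L^2$-orthogonal to the infinitesimal rigid motions. Let $W_h=Z_h\supseteq M_h$ be a space of continuous piecewise polynomials. The pair $(\mathbf V_h,M_h)$ satisfies the discrete inf-sup condition with a constant $\beta_1>0$: $$\sup_{\mathbf v_h\in\mathbf V_h}\frac{(\operatorname{div}\mathbf v_h,\varphi_h)}{\|\mathbf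 v_h\|_{H^1(\Omega)}}\ge\beta_1\|\varphi_h\|\qquad\forall\varphi_h\in M_h .$$ **Algorithm (MFEA, $\theta=0$).** Let $t_f>0$, $\Delta t=t_f/N$, $d_tv^n=(v^n-v^{n-1})/\Delta t$. Let $\mathbf u_h^0\in\mathbf V_h$ be the elliptic projection of $\mathbf u_0$, that is, $(\nabla\mathbf u_h^0,\nabla\mathbf w_h)=(\nabla\mathbf u_0,\nabla\mathbf w_h)$ for all $\mathbf w_h\in\mathbf V_h$. Let $p_h^0,T_h^0\in W_h$ be the $L^2$-projections of $p_0,T_0$. Put $q_h^0=\operatorname{div}\mathbf u_h^0$, $\varpi_h^0=c_0p_h^0-b_0T_h^0+\alpha q_h^0$, $\tau_h^0=\alpha p_h^0-(\lambda+\mu)q_h^0+\beta T_h^0$, $\varsigma_h^0=a_0T_h^0-b_0p_h^0+\beta q_h^0$. For $n=0,\dots,N-1$ let $(\mathbf u_h^{n+1},\tau_h^{n+1},\varpi_h^{n+1},\varsigma_h^{n+1})\in\mathbf V_h\times M_h\times W_h\times W_h$ satisfy, for all $\mathbf v_h\in\mathbf V_h$, $\varphi_h\in M_h$, $y_h,z_h\in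 W_h$, $$\mu(\nabla\mathbf u_h^{n+1},\nabla\mathbf v_h)-(\tau_h^{n+1},\operatorname{div}\mathbf v_h)=(\mathbf f,\mathbf v_h)+\langle\mathbf f_1,\mathbf v_h\rangle,$$ $$\gamma_6(\tau_h^{n+1},\varphi_h)+(\operatorname{div}\mathbf u_h^{n+1},\varphi_h)=\gamma_4(\varpi_h^{n},\varphi_h)+\gamma_1(\varsigma_h^{n},\varphi_h),$$ $$(d_t\varpi_h^{n+1},y_h)+\bigl(k(\tau_h^{n+1})\nabla(\gamma_4\tau_h^{n+1}+\gamma_5\varpi_h^{n+1}+\gamma_2\varsigma_h^{n+1}),\nabla y_h\bigr)=(g,y_h)+\langle g_1,y_h\rangle,$$ $$(d_t\varsigma_h^{n+1},z_h)+\bigl(\boldsymbol\Theta\nabla(\gamma_1\tau_h^{n+1}+\gamma_2\varpi_h^{n+1}+\gamma_3\varsigma_h^{n+1}),\nabla z_h\bigr)=(\phi,z_h)+\langle\phi_1,z_h\rangle,$$ and put $$p_h^{n+1}=\gamma_4\tau_h^{n+1}+\gamma_5\varpi_h^n+\gamma_2\varsigma_h^n,\quad T_h^{n+1}=\gamma_1\tau_h^{n+1}+\gamma_2\varpi_h^n+\gamma_3\varsigma_h^n,\quad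 q_h^{n+1}=-\gamma_6\tau_h^{n+1}+\gamma_4\varpi_h^n+\gamma_1\varsigma_h^n .$$ **Statement.** There is a constant $C>0$, depending only on $d$, $\mu,\lambda,a_0,b_0,c_0,\alpha,\beta$, $k_M$, $\theta_M$, $\beta_1$, $\rho$ and $j$ (in particular not on $h$, $\Delta t$, $l$, the data or the solution), such that whenever $\Delta t\le C h^2$, $$J_{h,0}^{l}+\hat S_{h,0}^{l}\le J_{h,0}^{0}\qquad\text{for all } l\ge1\text{ with } l+1\le N,$$ where $$J_{h,0}^{l}=\tfrac12\bigl[\mu\|\nabla\mathbf u_h^{l+1}\|^2+\gamma_6\|\tau_h^{l+1}\|^2+(\gamma_5+\gamma_2)\|\varpi_h^{l}\|^2+(\gamma_3+\gamma_2)\|\varsigma_h^{l}\|^2-\gamma_2\|\varsigma_h^{l}-\varpi_h^{l}\|^2-2(\mathbf f,\mathbf u_h^{l+1})-2\langle\mathbf f_1,\mathbf u_h^{l+1}\rangle\bigr],$$ $$\begin{aligned}\hat S_{h,0}^{l}=\Delta t\sum_{n=1}^{l}\Bigl[&\tfrac{\mu}{4}\Delta t\|d_t\nabla\mathbf u_h^{n+1}\|^2+\tfrac{k_m}{2}\|\nabla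 p_h^{n+1}\|^2+\tfrac{\theta_m}{2}\|\nabla T_h^{n+1}\|^2+\tfrac{(\gamma_2+\gamma_5)\Delta t}{2}\|d_t\varpi_h^n\|^2+\tfrac{(\gamma_2+\gamma_3)\Delta t}{2}\|d_t\varsigma_h^n\|^2\\&-\tfrac{\gamma_2\Delta t}{2}\|d_t\varsigma_h^n-d_t\varpi_h^n\|^2+\tfrac{\gamma_6\Delta t}{2}\|d_t\tau_h^{n+1}\|^2-(g,p_h^{n+1})-\langle g_1,p_h^{n+1}\rangle-(\phi,T_h^{n+1})-\langle\phi_1,T_h^{n+1}\rangle\Bigr].\end{aligned}$$ -/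

import Mathlib

open MeasureTheory Set
open scoped Matrix ContDiff

noncomputable section

namespace ThermoPoro

/-- Euclidean space of dimension `d`. -/
abbrev Eu (d : ℕ) := EuclideanSpace ℝ (Fin d)

/-- The `i`-th standard unit vector. -/
def unit {d : ℕ} (i : Fin d) : Eu d := EuclideanSpace.single i 1

/-! ### Integrals over the domain and over its boundary -/

/-- The inner product `(φ, ψ)` of scalar functions in `L²(Ω)`. -/
def ip {d : ℕ} (Ω : Set (Eu d)) (φ ψ : Eu d → ℝ) : ℝ := ∫ x in Ω, φ x * ψ x

/-- The inner product `(u, v)` of vector fields in `L²(Ω)`. -/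
def ipVec {d : ℕ} (Ω : Set (Eu d)) (u v : Eu d → Eu d) : ℝ := ∫ x in Ω, inner ℝ (u x) (v x)

/-- The Frobenius product `A : B` of two linear maps (Jacobian matrices). -/
def frob {d : ℕ} (A B : Eu d →L[ℝ] Eu d) : ℝ := ∑ i, inner ℝ (A (unit i)) (B (unit i))

/-- The inner product of matrix fields in `L²(Ω)`. -/
def ipMat {d : ℕ} (Ω : Set (Eu d)) (A B : Eu d → (Eu d →L[ℝ] Eu d)) : ℝ :=
  ∫ x in Ω, frob (A x) (B x)

/-- The divergence of a vector field. -/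
def div {d : ℕ} (u : Eu d → Eu d) (x : Eu d) : ℝ := ∑ i, (fderiv ℝ u x (unit i)) i

/-- Squared `L²(Ω)` norm of a scalar function. -/
def nsq {d : ℕ} (Ω : Set (Eu d)) (φ : Eu d → ℝ) : ℝ := ip Ω φ φ

/-- `‖∇φ‖²` in `L²(Ω)` for a scalar function. -/
def gradNsq {d : ℕ} (Ω : Set (Eu d)) (φ : Eu d → ℝ) : ℝ :=
  ipVec Ω (gradient φ) (gradient φ)

/-- `‖∇u‖²` in `L²(Ω)` for a vector field. -/
def jacNsq {d : ℕ} (Ω : Set (Eu d)) (u : Eu d → Eu d) : ℝ :=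
  ipMat Ω (fderiv ℝ u) (fderiv ℝ u)

/-- The `H¹(Ω)` norm of a vector field. -/
def h1norm {d : ℕ} (Ω : Set (Eu d)) (u : Eu d → Eu d) : ℝ := √(ipVec Ω u u + jacNsq Ω u)

/-- `(d-1)`-dimensional surface measure: Hausdorff measure, normalised by the volume of the
`(d-1)`-dimensional ball of diameter one (Mathlib's Hausdorff measure gives weight `(diam s)^(d-1)`
to a covering set `s`). -/
def surfaceMeasure (d : ℕ) : Measure (Eu d) :=
  volume (Metric.ball (0 : Eu (d - 1)) (1 / 2)) •
    Measure.hausdorffMeasure (X := Eu d) ((d - 1 : ℕ) : ℝ)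

/-- Surface measure on `∂Ω`. -/
def bdry {d : ℕ} (Ω : Set (Eu d)) : Measure (Eu d) := (surfaceMeasure d).restrict (frontier Ω)

/-- `⟨φ, ψ⟩`, the inner product of `L²(∂Ω)`, scalar functions. -/
def bip {d : ℕ} (Ω : Set (Eu d)) (φ ψ : Eu d → ℝ) : ℝ := ∫ x, φ x * ψ x ∂(bdry Ω)

/-- `⟨u, v⟩`, the inner product of `L²(∂Ω)`, vector fields. -/
def bipVec {d : ℕ} (Ω : Set (Eu d)) (u v : Eu d → Eu d) : ℝ :=
  ∫ x, inner ℝ (u x) (v x) ∂(bdry Ω)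

/-! ### Domain, meshes, finite element spaces -/

/-- Non-degenerate closed `d`-simplices. -/
def IsSimplex {d : ℕ} (K : Set (Eu d)) : Prop :=
  ∃ v : Fin (d + 1) → Eu d, AffineIndependent ℝ v ∧ K = convexHull ℝ (range v)

/-- Non-degenerate closed axis-parallel boxes. -/
def IsBox {d : ℕ} (K : Set (Eu d)) : Prop :=
  ∃ a b : Eu d, (∀ i, a i < b i) ∧ K = {x | ∀ i, x i ∈ Icc (a i) (b i)}

/-- Bounded polygonal (polyhedral) domains: connected open sets whose closure is a finite union of
simplices and which fill the interior of their closure. -/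
structure IsPolygonalDomain {d : ℕ} (Ω : Set (Eu d)) : Prop where
  isOpen : IsOpen Ω
  isConnected : IsConnected Ω
  interior_closure : interior (closure Ω) = Ω
  polygonal : ∃ F : Finset (Set (Eu d)), (∀ K ∈ F, IsSimplex K) ∧ closure Ω = ⋃ K ∈ F, K

/-- `𝒯` is a conforming triangulation, or a conforming rectangular partition, of `Ω` with maximum
mesh size `h`; it is quasi-uniform with constant `ρ`: every element contains a ball of radius
`ρ h`. -/
structure IsQuasiUniformMesh {d : ℕ} (Ω : Set (Eu d)) (𝒯 : Finset (Set (Eu d))) (h ρ : ℝ) :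
    Prop where
  shape : (∀ K ∈ 𝒯, IsSimplex K) ∨ (∀ K ∈ 𝒯, IsBox K)
  cover : closure Ω = ⋃ K ∈ 𝒯, K
  disjoint : ∀ K ∈ 𝒯, ∀ K' ∈ 𝒯, K ≠ K' → Disjoint (interior K) (interior K')
  conforming : ∀ K ∈ 𝒯, ∀ K' ∈ 𝒯, K ≠ K' → IsExposed ℝ K (K ∩ K')
  diam_le : ∀ K ∈ 𝒯, Metric.diam K ≤ h
  diam_eq : ∃ K ∈ 𝒯, Metric.diam K = h
  ball : ∀ K ∈ 𝒯, ∃ x, Metric.closedBall x (ρ * h) ⊆ K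

/-- `φ` coincides on `K` with a polynomial of total degree at most `r`. -/
def IsPolyOn {d : ℕ} (r : ℕ) (K : Set (Eu d)) (φ : Eu d → ℝ) : Prop :=
  ∃ P : MvPolynomial (Fin d) ℝ, P.totalDegree ≤ r ∧
    ∀ x ∈ K, φ x = MvPolynomial.eval (fun i => x i) P

/-- Continuous functions on `closure Ω` that are polynomials of degree at most `r` on every element.
Functions are defined on the whole space; their values off `closure Ω` play no role. -/
def feSpace {d : ℕ} (Ω : Set (Eu d)) (𝒯 : Finset (Set (Eu d))) (r : ℕ) :
    Submodule ℝ (Eu d → ℝ) where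
  carrier := {φ | ContinuousOn φ (closure Ω) ∧ ∀ K ∈ 𝒯, IsPolyOn r K φ}
  zero_mem' := ⟨continuousOn_const, fun _ _ => ⟨0, by simp, fun _ _ => by simp⟩⟩
  add_mem' := by
    rintro φ ψ ⟨hφ, hφ'⟩ ⟨hψ, hψ'⟩
    refine ⟨hφ.add hψ, fun K hK => ?_⟩
    obtain ⟨P, hP, hP'⟩ := hφ' K hK
    obtain ⟨Q, hQ, hQ'⟩ := hψ' K hK
    exact ⟨P + Q, (MvPolynomial.totalDegree_add P Q).trans (max_le hP hQ),
      fun x hx => by simp [hP' x hx, hQ' x hx]⟩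
  smul_mem' := by
    rintro c φ ⟨hφ, hφ'⟩
    refine ⟨hφ.const_smul c, fun K hK => ?_⟩
    obtain ⟨P, hP, hP'⟩ := hφ' K hK
    exact ⟨c • P, (MvPolynomial.totalDegree_smul_le c P).trans hP,
      fun x hx => by simp [hP' x hx]⟩

/-- Infinitesimal rigid motions `x ↦ a + A x` with `A` skew-symmetric. -/
def rigidMotions (d : ℕ) : Set (Eu d → Eu d) :=
  {r | ∃ (a : Eu d) (A : Matrix (Fin d) (Fin d) ℝ), Aᵀ = -A ∧
    ∀ x, r x = a + WithLp.toLp 2 (A *ᵥ x.ofLp)}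

/-- The displacement space `V_h`: continuous piecewise polynomial vector fields of degree at most
`r`, `L²(Ω)`-orthogonal to the rigid motions. -/
def dispSpace {d : ℕ} (Ω : Set (Eu d)) (𝒯 : Finset (Set (Eu d))) (r : ℕ) : Set (Eu d → Eu d) :=
  {v | (∀ i, (fun x => v x i) ∈ feSpace Ω 𝒯 r) ∧ ∀ w ∈ rigidMotions d, ipVec Ω v w = 0}

/-- The discrete inf-sup condition with constant `β₁` for the pair of `dispSpace Ω 𝒯 i` and
`feSpace Ω 𝒯 j`. -/
def DiscreteInfSup {d : ℕ} (Ω : Set (Eu d)) (𝒯 : Finset (Set (Eu d))) (i j : ℕ) (β₁ : ℝ) : Prop :=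
  ∀ φ ∈ feSpace Ω 𝒯 j,
    β₁ * √(nsq Ω φ) ≤ ⨆ v : dispSpace Ω 𝒯 i, ip Ω (div v.1) φ / h1norm Ω v.1

/-! ### Coefficients -/

/-- The physical constants of the model. -/
structure Coeffs where
  (μ lam a₀ b₀ c₀ α β : ℝ)

namespace Coeffs

/-- Sign conditions on the physical constants. -/
structure Admissible (P : Coeffs) : Prop where
  μ_pos : 0 < P.μ
  lam_add_μ_pos : 0 < P.lam + P.μ
  a₀_nonneg : 0 ≤ P.a₀
  b₀_nonneg : 0 ≤ P.b₀
  c₀_nonneg : 0 ≤ P.c₀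
  α_nonneg : 0 ≤ P.α
  β_nonneg : 0 ≤ P.β
  b₀_lt_c₀ : P.b₀ < P.c₀
  b₀_lt_a₀ : P.b₀ < P.a₀

variable (P : Coeffs)

/-- The common denominator, and below it the coefficients `γ₁, …, γ₆` of the inverse of the change
of variables `ϖ = c₀ p - b₀ T + α q`, `τ = α p - (λ + μ) q + β T`, `ς = a₀ T - b₀ p + β q`, namely
`T = γ₁ τ + γ₂ ϖ + γ₃ ς`, `p = γ₄ τ + γ₅ ϖ + γ₂ ς`, `q = -γ₆ τ + γ₄ ϖ + γ₁ ς`.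
(A factor `α`, common to all numerators and to the denominator, is cancelled.) -/
def den : ℝ :=
  P.c₀ * P.β ^ 2 + 2 * P.α * P.β * P.b₀ + P.a₀ * P.α ^ 2 +
    (P.c₀ * P.a₀ - P.b₀ ^ 2) * (P.lam + P.μ)

def γ₁ : ℝ := (P.β * P.c₀ + P.α * P.b₀) / P.den

def γ₂ : ℝ := (P.b₀ * (P.lam + P.μ) - P.α * P.β) / P.den

def γ₃ : ℝ := (P.α ^ 2 + P.c₀ * (P.lam + P.μ)) / P.den

def γ₄ : ℝ := (P.a₀ * P.α + P.β * P.b₀) / P.den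

def γ₅ : ℝ := (P.a₀ * (P.lam + P.μ) + P.β ^ 2) / P.den

def γ₆ : ℝ := (P.c₀ * P.a₀ - P.b₀ ^ 2) / P.den

end Coeffs

/-- Permeability: a continuous function of `τ`, strictly between `k_m > 0` and `k_M`. -/
structure IsPermeability (k : ℝ → ℝ) (k_m k_M : ℝ) : Prop where
  continuous : Continuous k
  pos : 0 < k_m
  lower : ∀ s, k_m < k s
  upper : ∀ s, k s < k_M

/-- Thermal conductivity: a measurable field of symmetric matrices with spectrum in
`[θ_m, θ_M]`, where `θ_m > 0`. -/
structure IsConductivity {d : ℕ} (Θ : Eu d → Matrix (Fin d) (Fin d) ℝ) (θ_m θ_M : ℝ) : Prop where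
  measurable : ∀ i j, Measurable fun x => Θ x i j
  symm : ∀ x, (Θ x)ᵀ = Θ x
  pos : 0 < θ_m
  lower : ∀ x, ∀ ζ : Eu d, θ_m * ‖ζ‖ ^ 2 ≤ ζ.ofLp ⬝ᵥ (Θ x *ᵥ ζ.ofLp)
  upper : ∀ x, ∀ ζ : Eu d, ζ.ofLp ⬝ᵥ (Θ x *ᵥ ζ.ofLp) ≤ θ_M * ‖ζ‖ ^ 2

/-- The form `(k(τ) ∇p, ∇y)`. -/
def permForm {d : ℕ} (Ω : Set (Eu d)) (k : ℝ → ℝ) (τ p y : Eu d → ℝ) : ℝ :=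
  ∫ x in Ω, k (τ x) * inner ℝ (gradient p x) (gradient y x)

/-- The form `(Θ ∇T, ∇z)`. -/
def heatForm {d : ℕ} (Ω : Set (Eu d)) (Θ : Eu d → Matrix (Fin d) (Fin d) ℝ)
    (T z : Eu d → ℝ) : ℝ :=
  ∫ x in Ω, (gradient z x).ofLp ⬝ᵥ (Θ x *ᵥ (gradient T x).ofLp)

/-! ### Data -/

/-- `G` is the weak Jacobian of the vector field `u` in `Ω`. -/
def IsWeakJacobian {d : ℕ} (Ω : Set (Eu d)) (u : Eu d → Eu d) (G : Eu d → (Eu d →L[ℝ] Eu d)) :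
    Prop :=
  ∀ η : Eu d → ℝ, ContDiff ℝ ∞ η → HasCompactSupport η → tsupport η ⊆ Ω → ∀ e : Eu d,
    ∫ x in Ω, (fderiv ℝ η x e) • u x = -∫ x in Ω, η x • G x e

/-- Initial data `u₀` (with weak Jacobian `Du₀`), `p₀`, `T₀`, body force `f` and traction `f₁`,
fluid source `g` and flux `g₁`, heat source `ϕ` and flux `ϕ₁`. -/
structure Data (d : ℕ) where
  (u₀ : Eu d → Eu d)
  (Du₀ : Eu d → (Eu d →L[ℝ] Eu d))
  (p₀ T₀ : Eu d → ℝ)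
  (f f₁ : Eu d → Eu d)
  (g g₁ ϕ ϕ₁ : Eu d → ℝ)

/-- `u₀ ∈ H¹(Ω)`; `p₀, T₀, f, g, ϕ ∈ L²(Ω)`; `f₁, g₁, ϕ₁ ∈ L²(∂Ω)`. -/
structure Data.Regular {d : ℕ} (D : Data d) (Ω : Set (Eu d)) : Prop where
  u₀ : MemLp D.u₀ 2 (volume.restrict Ω)
  Du₀ : MemLp D.Du₀ 2 (volume.restrict Ω)
  weak : IsWeakJacobian Ω D.u₀ D.Du₀
  p₀ : MemLp D.p₀ 2 (volume.restrict Ω)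
  T₀ : MemLp D.T₀ 2 (volume.restrict Ω)
  f : MemLp D.f 2 (volume.restrict Ω)
  g : MemLp D.g 2 (volume.restrict Ω)
  ϕ : MemLp D.ϕ 2 (volume.restrict Ω)
  f₁ : MemLp D.f₁ 2 (bdry Ω)
  g₁ : MemLp D.g₁ 2 (bdry Ω)
  ϕ₁ : MemLp D.ϕ₁ 2 (bdry Ω)

/-! ### The algorithm -/

/-- The backward difference quotient `d_t vⁿ = (vⁿ - vⁿ⁻¹) / Δt`, for `n ≥ 1`. -/
def bdiff {F : Type*} [AddCommGroup F] [Module ℝ F] (Δt : ℝ) (v : ℕ → F) (n : ℕ) : F :=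
  Δt⁻¹ • (v n - v (n - 1))

/-- Discrete trajectories. -/
structure Trajectory (d : ℕ) where
  (u : ℕ → Eu d → Eu d)
  (τ ϖ ς p T q : ℕ → Eu d → ℝ)

/-- `S` is computed by the multiphysics finite element algorithm with time step `Δt`, for the time
levels `0, …, N`. Here `θ = 0` is the decoupled and `θ = 1` the coupled variant, `V = V_h`,
`M = M_h`, and `W = W_h = Z_h`. -/
structure IsMFEA {d : ℕ} (θ : ℕ) (P : Coeffs) (Ω : Set (Eu d)) (k : ℝ → ℝ)
    (Θ : Eu d → Matrix (Fin d) (Fin d) ℝ) (D : Data d) (V : Set (Eu d → Eu d))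
    (M W : Submodule ℝ (Eu d → ℝ)) (Δt : ℝ) (N : ℕ) (S : Trajectory d) : Prop where
  /- initial values: elliptic projection of `u₀`, `L²` projections of `p₀` and `T₀` -/
  u_zero_mem : S.u 0 ∈ V
  u_zero : ∀ w ∈ V, ipMat Ω (fderiv ℝ (S.u 0)) (fderiv ℝ w) = ipMat Ω D.Du₀ (fderiv ℝ w)
  p_zero_mem : S.p 0 ∈ W
  p_zero : ∀ ψ ∈ W, ip Ω (S.p 0) ψ = ip Ω D.p₀ ψ
  T_zero_mem : S.T 0 ∈ W
  T_zero : ∀ ψ ∈ W, ip Ω (S.T 0) ψ = ip Ω D.T₀ ψ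
  q_zero : S.q 0 = div (S.u 0)
  ϖ_zero : S.ϖ 0 = P.c₀ • S.p 0 - P.b₀ • S.T 0 + P.α • S.q 0
  τ_zero : S.τ 0 = P.α • S.p 0 - (P.lam + P.μ) • S.q 0 + P.β • S.T 0
  ς_zero : S.ς 0 = P.a₀ • S.T 0 - P.b₀ • S.p 0 + P.β • S.q 0
  /- one time step -/
  u_mem : ∀ n < N, S.u (n + 1) ∈ V
  τ_mem : ∀ n < N, S.τ (n + 1) ∈ M
  ϖ_mem : ∀ n < N, S.ϖ (n + 1) ∈ W
  ς_mem : ∀ n < N, S.ς (n + 1) ∈ W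
  momentum : ∀ n < N, ∀ v ∈ V,
    P.μ * ipMat Ω (fderiv ℝ (S.u (n + 1))) (fderiv ℝ v) - ip Ω (S.τ (n + 1)) (div v) =
      ipVec Ω D.f v + bipVec Ω D.f₁ v
  constraint : ∀ n < N, ∀ φ ∈ M,
    P.γ₆ * ip Ω (S.τ (n + 1)) φ + ip Ω (div (S.u (n + 1))) φ =
      P.γ₄ * ip Ω (S.ϖ (n + θ)) φ + P.γ₁ * ip Ω (S.ς (n + θ)) φ
  mass : ∀ n < N, ∀ y ∈ W,
    ip Ω (bdiff Δt S.ϖ (n + 1)) y +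
        permForm Ω k (S.τ (n + 1))
          (P.γ₄ • S.τ (n + 1) + P.γ₅ • S.ϖ (n + 1) + P.γ₂ • S.ς (n + 1)) y =
      ip Ω D.g y + bip Ω D.g₁ y
  heat : ∀ n < N, ∀ z ∈ W,
    ip Ω (bdiff Δt S.ς (n + 1)) z +
        heatForm Ω Θ (P.γ₁ • S.τ (n + 1) + P.γ₂ • S.ϖ (n + 1) + P.γ₃ • S.ς (n + 1)) z =
      ip Ω D.ϕ z + bip Ω D.ϕ₁ z
  T_step : ∀ n < N,
    S.T (n + 1) = P.γ₁ • S.τ (n + 1) + P.γ₂ • S.ϖ (n + θ) + P.γ₃ • S.ς (n + θ)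
  p_step : ∀ n < N,
    S.p (n + 1) = P.γ₄ • S.τ (n + 1) + P.γ₅ • S.ϖ (n + θ) + P.γ₂ • S.ς (n + θ)
  q_step : ∀ n < N,
    S.q (n + 1) = -P.γ₆ • S.τ (n + 1) + P.γ₄ • S.ϖ (n + θ) + P.γ₁ • S.ς (n + θ)

/-! ### Discrete energy and dissipation -/

/-- The discrete energy `J_{h,θ}^l`. -/
def energy {d : ℕ} (θ : ℕ) (P : Coeffs) (Ω : Set (Eu d)) (D : Data d) (S : Trajectory d)
    (l : ℕ) : ℝ :=
  (1 / 2) * (P.μ * jacNsq Ω (S.u (l + 1)) + P.γ₆ * nsq Ω (S.τ (l + 1))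
    + (P.γ₅ + P.γ₂) * nsq Ω (S.ϖ (l + θ)) + (P.γ₃ + P.γ₂) * nsq Ω (S.ς (l + θ))
    - P.γ₂ * nsq Ω (S.ς (l + θ) - S.ϖ (l + θ))
    - 2 * ipVec Ω D.f (S.u (l + 1)) - 2 * bipVec Ω D.f₁ (S.u (l + 1)))

/-- The quantity `Ŝ_{h,0}^l` of the decoupled variant. -/
def dissipation {d : ℕ} (P : Coeffs) (Ω : Set (Eu d)) (k_m θ_m : ℝ) (D : Data d) (Δt : ℝ)
    (S : Trajectory d) (l : ℕ) : ℝ :=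
  Δt * ∑ n ∈ Finset.Icc 1 l,
    (P.μ / 4 * Δt * jacNsq Ω (bdiff Δt S.u (n + 1))
      + k_m / 2 * gradNsq Ω (S.p (n + 1)) + θ_m / 2 * gradNsq Ω (S.T (n + 1))
      + (P.γ₂ + P.γ₅) * Δt / 2 * nsq Ω (bdiff Δt S.ϖ n)
      + (P.γ₂ + P.γ₃) * Δt / 2 * nsq Ω (bdiff Δt S.ς n)
      - P.γ₂ * Δt / 2 * nsq Ω (bdiff Δt S.ς n - bdiff Δt S.ϖ n)
      + P.γ₆ * Δt / 2 * nsq Ω (bdiff Δt S.τ (n + 1))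
      - ip Ω D.g (S.p (n + 1)) - bip Ω D.g₁ (S.p (n + 1))
      - ip Ω D.ϕ (S.T (n + 1)) - bip Ω D.ϕ₁ (S.T (n + 1)))

end ThermoPoro

end

open ThermoPoro

/-! The law comes from one time step, then telescoping. Write `δv` for the increment of `v` between
consecutive levels. Test the momentum equation at level `m+2` with `δu`, the difference of the
constraints at levels `m+2` and `m+1` with `τ^{m+2}`, and the mass and heat equations at level `m+1`
with `p^{m+2}` and `T^{m+2}`. The couplings of `τ` with `div u`, `ϖ` and `ς` cancel. Since `γ₂`
occurs symmetrically in `p` and `T`, the rest consists of differences of squares, by `2a(a - b) = a²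
- b² + (a - b)²`. This is pure algebra; no sign of any `γ` is needed.

The only defect is the time lag of `τ`: the diffusion terms contain `p^{m+2} - γ₄ δτ` and `T^{m+2} -
γ₁ δτ`, not the test functions. Young's inequality (`le_permForm`, `le_heatForm`) keeps half of the
dissipation and leaves a multiple of `Δt ‖∇δτ‖²`. The inverse estimate (`exists_inverse_estimate`)
bounds `‖∇δτ‖²` by `c h⁻² ‖δτ‖²`; the inf-sup condition and the difference of two momentum equations
(`DiscreteInfSup.sq_mul_nsq_le`) bound `‖δτ‖` by `(μ/β₁) ‖∇δu‖`. When `Δt ≤ C h²` the error is thus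
at most `μ/4 ‖∇δu‖²`, half of the numerical dissipation `μ/2 ‖∇δu‖²` of the implicit step. The other
half stays in `Ŝ`.

The inverse estimate is applied in `M_h` only, so `C` depends on `j` and not on the degrees in `V_h`
or `W_h`. -/

noncomputable section

namespace ThermoPoro

/-! ### Polynomial functions -/

/-- Polynomial functions of total degree at most `r`. -/
def polySpace (d r : ℕ) : Submodule ℝ (Eu d → ℝ) :=
  (MvPolynomial.restrictTotalDegree (Fin d) ℝ r).map
    (LinearMap.pi fun x : Eu d => (MvPolynomial.aeval x.ofLp).toLinearMap)

instance (d r : ℕ) : FiniteDimensional ℝ (polySpace d r) := by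
  have : FiniteDimensional ℝ (MvPolynomial.restrictTotalDegree (Fin d) ℝ r) := inferInstance
  unfold polySpace
  infer_instance

theorem mem_polySpace {d r : ℕ} {f : Eu d → ℝ} : f ∈ polySpace d r ↔
    ∃ P : MvPolynomial (Fin d) ℝ, P.totalDegree ≤ r ∧
      ∀ x : Eu d, f x = MvPolynomial.eval (fun i => x i) P := by
  constructor
  · rintro ⟨P, hP, rfl⟩
    exact ⟨P, (MvPolynomial.mem_restrictTotalDegree _ _ _).1 hP, fun x => rfl⟩
  · rintro ⟨P, hP, h⟩
    exact ⟨P, (MvPolynomial.mem_restrictTotalDegree _ _ _).2 hP, funext fun x => (h x).symm⟩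

theorem isPolyOn_iff {d r : ℕ} {K : Set (Eu d)} {φ : Eu d → ℝ} :
    IsPolyOn r K φ ↔ ∃ f ∈ polySpace d r, EqOn φ f K := by
  constructor
  · rintro ⟨P, hP, h⟩
    exact ⟨fun x => MvPolynomial.eval (fun i => x i) P, mem_polySpace.2 ⟨P, hP, fun _ => rfl⟩, h⟩
  · rintro ⟨f, hf, h⟩
    obtain ⟨P, hP, hfP⟩ := mem_polySpace.1 hf
    exact ⟨P, hP, fun x hx => (h hx).trans (hfP x)⟩

theorem analyticOnNhd_of_mem_polySpace {d r : ℕ} {f : Eu d → ℝ} (hf : f ∈ polySpace d r) :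
    AnalyticOnNhd ℝ f univ := by
  obtain ⟨P, -, h⟩ := mem_polySpace.1 hf
  have : f = fun x => MvPolynomial.eval (fun i => x i) P := funext h
  rw [this]
  exact AnalyticOnNhd.aeval_mvPolynomial (A := ℝ) (f := fun x : Eu d => fun i => x i)
    (fun i x _ => (EuclideanSpace.proj i : Eu d →L[ℝ] ℝ).analyticAt x) P

theorem contDiff_of_mem_polySpace {d r : ℕ} {f : Eu d → ℝ} (hf : f ∈ polySpace d r) :
    ContDiff ℝ ω f := by
  rw [← contDiffOn_univ]
  exact (analyticOnNhd_of_mem_polySpace hf).contDiffOn uniqueDiffOn_univ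

theorem continuous_of_mem_polySpace {d r : ℕ} {f : Eu d → ℝ} (hf : f ∈ polySpace d r) :
    Continuous f := (contDiff_of_mem_polySpace hf).continuous

theorem continuous_fderiv_of_mem_polySpace {d r : ℕ} {f : Eu d → ℝ} (hf : f ∈ polySpace d r) :
    Continuous (fderiv ℝ f) :=
  (contDiff_of_mem_polySpace hf).continuous_fderiv (by simp)

theorem differentiable_of_mem_polySpace {d r : ℕ} {f : Eu d → ℝ} (hf : f ∈ polySpace d r) :
    Differentiable ℝ f := (contDiff_of_mem_polySpace hf).differentiable (by simp)

/-- Substituting polynomials of degree at most one does not raise the degree. -/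
theorem totalDegree_bind₁_le {σ : Type*} (g : σ → MvPolynomial σ ℝ)
    (hg : ∀ i, (g i).totalDegree ≤ 1) (P : MvPolynomial σ ℝ) :
    (MvPolynomial.bind₁ g P).totalDegree ≤ P.totalDegree := by
  classical
  conv_lhs => rw [P.as_sum, map_sum]
  refine (MvPolynomial.totalDegree_finsetSum _ _).trans (Finset.sup_le fun m hm => ?_)
  rw [MvPolynomial.bind₁_monomial]
  refine (MvPolynomial.totalDegree_mul _ _).trans ?_
  rw [MvPolynomial.totalDegree_C, zero_add]
  refine (MvPolynomial.totalDegree_finsetProd _ _).trans ?_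
  refine le_trans (Finset.sum_le_sum fun i _ => ?_) (MvPolynomial.le_totalDegree hm)
  refine (MvPolynomial.totalDegree_pow _ _).trans ?_
  simpa using Nat.mul_le_mul_left (m i) (hg i)

/-- This invariance lets one fixed pair of concentric reference balls serve every element, whatever
its shape. -/
theorem polySpace_comp_affine {d r : ℕ} {f : Eu d → ℝ} (hf : f ∈ polySpace d r) (x₀ : Eu d)
    (h : ℝ) : (fun y => f (x₀ + h • y)) ∈ polySpace d r := by
  obtain ⟨P, hP, hfP⟩ := mem_polySpace.1 hf
  refine mem_polySpace.2 ⟨MvPolynomial.bind₁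
    (fun i => MvPolynomial.C (x₀ i) + MvPolynomial.C h * MvPolynomial.X i) P,
    (totalDegree_bind₁_le _ (fun i => ?_) P).trans hP, fun y => ?_⟩
  · refine (MvPolynomial.totalDegree_add _ _).trans (max_le (by simp) ?_)
    refine (MvPolynomial.totalDegree_mul _ _).trans (by simp)
  · rw [hfP, ← MvPolynomial.aeval_eq_eval, ← MvPolynomial.aeval_eq_eval, MvPolynomial.aeval_bind₁]
    simp

/-! ### Inverse estimate: norm equivalence and scaling. -/

/-- On a finite-dimensional space, the seminorm induced by any linear map is controlled by the norm
induced by an injective linear map. -/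
theorem exists_norm_le_mul_norm_of_injective {V X Y : Type*} [AddCommGroup V] [Module ℝ V]
    [FiniteDimensional ℝ V] [NormedAddCommGroup X] [NormedSpace ℝ X] [NormedAddCommGroup Y]
    [NormedSpace ℝ Y] (T : V →ₗ[ℝ] X) (G : V →ₗ[ℝ] Y) (hT : Function.Injective T) :
    ∃ a : ℝ, 0 ≤ a ∧ ∀ v, ‖G v‖ ≤ a * ‖T v‖ := by
  let L := LinearEquiv.ofInjective T hT
  -- `G` factors through the finite-dimensional range of `T`, where every linear map is bounded.
  let A := LinearMap.toContinuousLinearMap (G ∘ₗ L.symm.toLinearMap)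
  refine ⟨‖A‖, A.opNorm_nonneg, fun v => ?_⟩
  have h1 : A (L v) = G v := by simp [A]
  rw [← h1]
  exact A.le_opNorm (L v)

/-- On polynomials of bounded degree, the supremum of the gradient over the unit ball is controlled
by the `L²` norm over a concentric ball. -/
theorem exists_norm_fderiv_sq_le_integral (d r : ℕ) {ρ : ℝ} (hρ : 0 < ρ) :
    ∃ c : ℝ, 0 ≤ c ∧ ∀ f ∈ polySpace d r, ∀ y ∈ Metric.closedBall (0 : Eu d) 1,
      ‖fderiv ℝ f y‖ ^ 2 ≤ c * ∫ x in Metric.closedBall (0 : Eu d) ρ, f x ^ 2 := by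
  set B : Set (Eu d) := Metric.closedBall 0 ρ
  set U : Set (Eu d) := Metric.closedBall 0 1
  set ν : Measure (Eu d) := volume.restrict B
  have : CompactSpace U := isCompact_iff_compactSpace.1 (isCompact_closedBall _ _)
  have hL : ∀ f : polySpace d r, MemLp f.1 2 ν := fun f =>
    (memLp_two_iff_integrable_sq (continuous_of_mem_polySpace f.2).aestronglyMeasurable).2
      (((continuous_of_mem_polySpace f.2).pow 2).continuousOn.integrableOn_compact
        (isCompact_closedBall _ _))
  let T : polySpace d r →ₗ[ℝ] Lp ℝ 2 ν :=
    { toFun := fun f => (hL f).toLp f.1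
      map_add' := fun f g => MemLp.toLp_add (hL f) (hL g)
      map_smul' := fun c f => MemLp.toLp_const_smul c (hL f) }
  let G : polySpace d r →ₗ[ℝ] C(U, Eu d →L[ℝ] ℝ) :=
    { toFun := fun f => ⟨fun y => fderiv ℝ f.1 y,
        (continuous_fderiv_of_mem_polySpace f.2).comp continuous_subtype_val⟩
      map_add' := fun f g => by
        ext1 y
        exact fderiv_add (differentiable_of_mem_polySpace f.2 y)
          (differentiable_of_mem_polySpace g.2 y)
      map_smul' := fun c f => by
        ext1 y
        exact fderiv_const_smul (differentiable_of_mem_polySpace f.2 y) c }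
  -- A polynomial that is zero in `L²` of the small ball vanishes on its interior by continuity,
  -- hence everywhere by analyticity.
  have hT : Function.Injective T := by
    rw [← LinearMap.ker_eq_bot, LinearMap.ker_eq_bot']
    intro f hf
    have h0 : f.1 =ᵐ[ν] 0 := by
      have h00 := (hL f).coeFn_toLp
      have : (hL f).toLp f.1 = 0 := hf
      rw [this] at h00
      exact h00.symm.trans (Lp.coeFn_zero ℝ 2 ν)
    have h1 : EqOn f.1 0 (Metric.ball 0 ρ) :=
      Measure.eqOn_open_of_ae_eq
        (ae_mono (Measure.restrict_mono Metric.ball_subset_closedBall le_rfl) h0)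
        Metric.isOpen_ball (continuous_of_mem_polySpace f.2).continuousOn continuousOn_const
    have h2 := AnalyticOnNhd.eq_of_eventuallyEq (z₀ := (0 : Eu d))
      (analyticOnNhd_of_mem_polySpace f.2)
      (analyticOnNhd_const (v := (0 : ℝ)))
      (h1.eventuallyEq_of_mem (Metric.ball_mem_nhds _ hρ))
    exact Subtype.ext h2
  obtain ⟨a, ha, hGT⟩ := exists_norm_le_mul_norm_of_injective
    (Y := C(U, Eu d →L[ℝ] ℝ)) T G hT
  refine ⟨a ^ 2, by positivity, fun f hf y hy => ?_⟩
  have h2 : ‖fderiv ℝ f y‖ ≤ a * ‖T ⟨f, hf⟩‖ :=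
    ((G ⟨f, hf⟩).norm_coe_le_norm ⟨y, hy⟩).trans (hGT _)
  have h3 : ‖T ⟨f, hf⟩‖ ^ 2 = ∫ x in B, f x ^ 2 := by
    rw [← real_inner_self_eq_norm_sq, L2.inner_def]
    refine integral_congr_ae ?_
    filter_upwards [(hL ⟨f, hf⟩).coeFn_toLp] with x hx
    change inner ℝ ((hL ⟨f, hf⟩).toLp f x) ((hL ⟨f, hf⟩).toLp f x) = _
    rw [hx]
    simp [sq]
  rw [← h3, ← mul_pow]
  gcongr

/-- Inverse estimate on one element. -/
theorem exists_inverse_estimate_element (d r : ℕ) {ρ : ℝ} (hρ : 0 < ρ) :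
    ∃ c : ℝ, 0 ≤ c ∧ ∀ (K : Set (Eu d)) (x₀ : Eu d) (h : ℝ), 0 < h → IsCompact K →
      Metric.closedBall x₀ (ρ * h) ⊆ K → K ⊆ Metric.closedBall x₀ h → ∀ f ∈ polySpace d r,
      ∫ x in K, ‖fderiv ℝ f x‖ ^ 2 ≤ c / h ^ 2 * ∫ x in K, f x ^ 2 := by
  obtain ⟨c, hc, H⟩ := exists_norm_fderiv_sq_le_integral d r hρ
  set b := volume.real (Metric.closedBall (0 : Eu d) 1)
  refine ⟨c * b, by positivity, fun K x₀ h hh hK hρK hKh f hf => ?_⟩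
  have hg := polySpace_comp_affine hf x₀ h
  have hint : IntegrableOn (fun x => f x ^ 2) K :=
    ((continuous_of_mem_polySpace hf).pow 2).continuousOn.integrableOn_compact hK
  -- Change of variables; the inner ball of radius `ρ h` lies in `K`.
  have hscale : ∫ y in Metric.closedBall (0 : Eu d) ρ, f (x₀ + h • y) ^ 2
      ≤ (h ^ d)⁻¹ * ∫ x in K, f x ^ 2 := by
    have h1 := Measure.setIntegral_comp_smul_of_pos volume (fun z : Eu d => f (x₀ + z) ^ 2)
      (Metric.closedBall (0 : Eu d) ρ) hh
    rw [h1, smul_eq_mul, finrank_euclideanSpace, Fintype.card_fin]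
    gcongr
    rw [smul_closedBall _ _ hρ.le, smul_zero, Real.norm_of_nonneg hh.le]
    have h2 := (measurePreserving_add_left (volume : Measure (Eu d)) x₀).setIntegral_preimage_emb
      (MeasurableEquiv.addLeft x₀).measurableEmbedding (fun x => f x ^ 2)
      (Metric.closedBall x₀ (h * ρ))
    have h3 : (fun x => x₀ + x) ⁻¹' Metric.closedBall x₀ (h * ρ) =
        Metric.closedBall (0 : Eu d) (h * ρ) := by
      ext x; simp
    rw [h3] at h2
    rw [h2, mul_comm h ρ]
    exact setIntegral_mono_set hint (ae_of_all _ fun x => sq_nonneg _) hρK.eventuallyLE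
  -- The chain rule contributes the factor `h⁻²`. The outer ball of radius `h` contains `K`, so the
  -- rescaled point lies in the unit ball.
  have hpt : ∀ x ∈ K, ‖fderiv ℝ f x‖ ^ 2 ≤ c / h ^ 2 * ((h ^ d)⁻¹ * ∫ x in K, f x ^ 2) := by
    intro x hx
    set y := h⁻¹ • (x - x₀)
    have hxy : x₀ + h • y = x := by simp [y, smul_smul, hh.ne']
    have hy : y ∈ Metric.closedBall (0 : Eu d) 1 := by
      have := hKh hx
      rw [mem_closedBall_iff_norm] at this
      rw [mem_closedBall_zero_iff, norm_smul, norm_inv, Real.norm_of_nonneg hh.le,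
        inv_mul_le_iff₀ hh, mul_one]
      exact this
    have hder : fderiv ℝ (fun y => f (x₀ + h • y)) y = h • fderiv ℝ f x := by
      have h1 : HasFDerivAt (fun y : Eu d => x₀ + h • y) (h • ContinuousLinearMap.id ℝ (Eu d)) y :=
        ((hasFDerivAt_id y).const_smul h).const_add x₀
      have h2 : HasFDerivAt f (fderiv ℝ f x) (x₀ + h • y) := by
        rw [hxy]; exact (differentiable_of_mem_polySpace hf x).hasFDerivAt
      rw [show (fun y => f (x₀ + h • y)) = f ∘ fun y => x₀ + h • y from rfl, (h2.comp y h1).fderiv]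
      ext v; simp
    have h3 := (H _ hg y hy).trans (mul_le_mul_of_nonneg_left hscale hc)
    rw [hder, norm_smul, mul_pow, Real.norm_of_nonneg hh.le] at h3
    rw [div_mul_eq_mul_div, le_div_iff₀ (by positivity)]
    linarith
  -- This volume cancels the `h⁻ᵈ` of the change of variables.
  have hvol : volume.real K ≤ h ^ d * b := by
    have : volume.real (Metric.closedBall x₀ h) = h ^ d * b := by
      rw [Measure.addHaar_real_closedBall' _ _ hh.le, finrank_euclideanSpace, Fintype.card_fin]
    rw [← this]
    exact measureReal_mono hKh (measure_closedBall_lt_top.ne)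
  have hI : 0 ≤ ∫ x in K, f x ^ 2 := integral_nonneg fun x => sq_nonneg _
  calc ∫ x in K, ‖fderiv ℝ f x‖ ^ 2
      ≤ ∫ x in K, c / h ^ 2 * ((h ^ d)⁻¹ * ∫ x in K, f x ^ 2) :=
        setIntegral_mono_on
          (((continuous_fderiv_of_mem_polySpace hf).norm.pow 2).continuousOn.integrableOn_compact hK)
          (integrableOn_const hK.measure_lt_top.ne) hK.measurableSet hpt
    _ = volume.real K * (c / h ^ 2 * ((h ^ d)⁻¹ * ∫ x in K, f x ^ 2)) := by
        rw [setIntegral_const, smul_eq_mul]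
    _ ≤ (h ^ d * b) * (c / h ^ 2 * ((h ^ d)⁻¹ * ∫ x in K, f x ^ 2)) := by gcongr
    _ = c * b / h ^ 2 * ∫ x in K, f x ^ 2 := by field_simp

/-! ### Square-integrable functions with square-integrable derivative -/

/-- `φ` is square-integrable and almost everywhere differentiable in `Ω`, with square-integrable
derivative. -/
structure SobReg {d : ℕ} {F : Type*} [NormedAddCommGroup F] [NormedSpace ℝ F]
    (Ω : Set (Eu d)) (φ : Eu d → F) : Prop where
  memLp : MemLp φ 2 (volume.restrict Ω)
  differentiableAt : ∀ᵐ x ∂(volume.restrict Ω), DifferentiableAt ℝ φ x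
  memLp_fderiv : MemLp (fderiv ℝ φ) 2 (volume.restrict Ω)

namespace SobReg

variable {d : ℕ} {F G : Type*} [NormedAddCommGroup F] [NormedSpace ℝ F]
  [NormedAddCommGroup G] [NormedSpace ℝ G] {Ω : Set (Eu d)} {φ ψ : Eu d → F}

/-- `fderiv` has a junk value where a function is not differentiable, for instance on element
interfaces, so linearity is available only almost everywhere. -/
theorem fderiv_sub_ae (hφ : SobReg Ω φ) (hψ : SobReg Ω ψ) :
    fderiv ℝ (φ - ψ) =ᵐ[volume.restrict Ω] fderiv ℝ φ - fderiv ℝ ψ := by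
  filter_upwards [hφ.differentiableAt, hψ.differentiableAt] with x h1 h2
  exact fderiv_sub h1 h2

theorem fderiv_smul_ae (hφ : SobReg Ω φ) (c : ℝ) :
    fderiv ℝ (c • φ) =ᵐ[volume.restrict Ω] c • fderiv ℝ φ := by
  filter_upwards [hφ.differentiableAt] with x h1
  exact fderiv_const_smul h1 c

theorem sub (hφ : SobReg Ω φ) (hψ : SobReg Ω ψ) : SobReg Ω (φ - ψ) where
  memLp := hφ.memLp.sub hψ.memLp
  differentiableAt := by
    filter_upwards [hφ.differentiableAt, hψ.differentiableAt] with x h1 h2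
    exact h1.sub h2
  memLp_fderiv := (memLp_congr_ae (hφ.fderiv_sub_ae hψ)).2 (hφ.memLp_fderiv.sub hψ.memLp_fderiv)

theorem smul (hφ : SobReg Ω φ) (c : ℝ) : SobReg Ω (c • φ) where
  memLp := hφ.memLp.const_smul c
  differentiableAt := by
    filter_upwards [hφ.differentiableAt] with x h1
    exact h1.const_smul c
  memLp_fderiv := (memLp_congr_ae (hφ.fderiv_smul_ae c)).2 (hφ.memLp_fderiv.const_smul c)

theorem add (hφ : SobReg Ω φ) (hψ : SobReg Ω ψ) : SobReg Ω (φ + ψ) := by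
  have h := hφ.sub (hψ.smul (-1))
  rwa [neg_one_smul, sub_neg_eq_add] at h

theorem zero : SobReg Ω (0 : Eu d → F) where
  memLp := MemLp.zero
  differentiableAt := ae_of_all _ fun x => differentiableAt_const (0 : F)
  memLp_fderiv := by
    have : fderiv ℝ (0 : Eu d → F) = 0 := by ext1 x; exact fderiv_const_apply (0 : F)
    rw [this]
    exact MemLp.zero (ε := Eu d →L[ℝ] F)

theorem sum {ι : Type*} (s : Finset ι) {f : ι → Eu d → F} (hf : ∀ i ∈ s, SobReg Ω (f i)) :
    SobReg Ω (∑ i ∈ s, f i) :=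
  Finset.sum_induction f (SobReg Ω) (fun _ _ => SobReg.add) SobReg.zero hf

theorem clm_comp (L : F →L[ℝ] G) (hφ : SobReg Ω φ) : SobReg Ω (fun x => L (φ x)) where
  memLp := L.comp_memLp' hφ.memLp
  differentiableAt := by
    filter_upwards [hφ.differentiableAt] with x h1
    exact L.differentiableAt.comp x h1
  memLp_fderiv := by
    have h : fderiv ℝ (fun x => L (φ x)) =ᵐ[volume.restrict Ω]
        fun x => ContinuousLinearMap.compL ℝ (Eu d) F G L (fderiv ℝ φ x) := by
      filter_upwards [hφ.differentiableAt] with x h1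
      exact (L.hasFDerivAt.comp x h1.hasFDerivAt).fderiv
    exact (memLp_congr_ae h).2 (ContinuousLinearMap.comp_memLp' _ hφ.memLp_fderiv)

theorem of_components {u : Eu d → Eu d} (hu : ∀ i, SobReg Ω (fun x => u x i)) : SobReg Ω u := by
  have h : u = ∑ i, fun x => (ContinuousLinearMap.toSpanSingleton ℝ (unit i : Eu d)) (u x i) := by
    ext x k
    simp [unit, Finset.sum_apply, Pi.single_apply]
  rw [h]
  exact SobReg.sum _ fun i _ => (hu i).clm_comp _

end SobReg

/-! ### Meshes -/

theorem IsSimplex.isCompact {d : ℕ} {K : Set (Eu d)} (hK : IsSimplex K) : IsCompact K := by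
  obtain ⟨v, -, rfl⟩ := hK
  exact (finite_range v).isCompact_convexHull ℝ

theorem IsSimplex.convex {d : ℕ} {K : Set (Eu d)} (hK : IsSimplex K) : Convex ℝ K := by
  obtain ⟨v, -, rfl⟩ := hK
  exact convex_convexHull ℝ _

theorem IsBox.eq_preimage {d : ℕ} {K : Set (Eu d)} (hK : IsBox K) :
    ∃ a b : Fin d → ℝ, K = EuclideanSpace.equiv (Fin d) ℝ ⁻¹' Icc a b := by
  obtain ⟨a, b, -, rfl⟩ := hK
  refine ⟨a.ofLp, b.ofLp, ?_⟩
  ext x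
  simp [Pi.le_def, forall_and]

theorem IsBox.isCompact {d : ℕ} {K : Set (Eu d)} (hK : IsBox K) : IsCompact K := by
  obtain ⟨a, b, rfl⟩ := hK.eq_preimage
  exact (EuclideanSpace.equiv (Fin d) ℝ).toHomeomorph.isCompact_preimage.2 isCompact_Icc

theorem IsBox.convex {d : ℕ} {K : Set (Eu d)} (hK : IsBox K) : Convex ℝ K := by
  obtain ⟨a, b, rfl⟩ := hK.eq_preimage
  exact (convex_Icc a b).linear_preimage (EuclideanSpace.equiv (Fin d) ℝ).toLinearMap

section Mesh

variable {d : ℕ} {Ω : Set (Eu d)} {𝒯 : Finset (Set (Eu d))} {h ρ : ℝ}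

namespace IsQuasiUniformMesh

theorem isCompact (hT : IsQuasiUniformMesh Ω 𝒯 h ρ) {K : Set (Eu d)} (hK : K ∈ 𝒯) :
    IsCompact K :=
  hT.shape.elim (fun H => (H K hK).isCompact) fun H => (H K hK).isCompact

theorem convex (hT : IsQuasiUniformMesh Ω 𝒯 h ρ) {K : Set (Eu d)} (hK : K ∈ 𝒯) :
    Convex ℝ K :=
  hT.shape.elim (fun H => (H K hK).convex) fun H => (H K hK).convex

/-- The frontier of a convex set is null. Hence the faces of the elements do not affect integrals.
-/
theorem interior_ae_eq (hT : IsQuasiUniformMesh Ω 𝒯 h ρ) {K : Set (Eu d)} (hK : K ∈ 𝒯) :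
    interior K =ᵐ[volume] K :=
  interior_ae_eq_of_null_frontier ((hT.convex hK).addHaar_frontier volume)

theorem subset_closure (hT : IsQuasiUniformMesh Ω 𝒯 h ρ) {K : Set (Eu d)} (hK : K ∈ 𝒯) :
    K ⊆ closure Ω := by
  rw [hT.cover]
  exact subset_biUnion_of_mem (u := fun K => K) hK

theorem isCompact_closure (hT : IsQuasiUniformMesh Ω 𝒯 h ρ) : IsCompact (closure Ω) := by
  rw [hT.cover]
  exact 𝒯.isCompact_biUnion fun K hK => hT.isCompact hK

theorem isFiniteMeasure (hT : IsQuasiUniformMesh Ω 𝒯 h ρ) :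
    IsFiniteMeasure (volume.restrict Ω) := by
  constructor
  rw [Measure.restrict_apply_univ]
  exact (measure_mono _root_.subset_closure).trans_lt hT.isCompact_closure.measure_lt_top

theorem ae_mem_interior (hT : IsQuasiUniformMesh Ω 𝒯 h ρ) (hΩ : IsOpen Ω) :
    ∀ᵐ x ∂(volume.restrict Ω), ∃ K ∈ 𝒯, x ∈ interior K := by
  have h1 : ∀ᵐ x, ∀ K ∈ 𝒯, (x ∈ interior K ↔ x ∈ K) :=
    (ae_ball_iff 𝒯.countable_toSet).2 fun K hK => (hT.interior_ae_eq hK).mem_iff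
  filter_upwards [ae_restrict_of_ae h1, ae_restrict_mem hΩ.measurableSet] with x hx hxΩ
  have : x ∈ closure Ω := _root_.subset_closure hxΩ
  rw [hT.cover] at this
  obtain ⟨K, hK, hxK⟩ := mem_iUnion₂.1 this
  exact ⟨K, hK, (hx K hK).2 hxK⟩

/-- Here `interior (closure Ω) = Ω` is essential: it rules out slits, which an element could cross.
-/
theorem interior_subset (hT : IsQuasiUniformMesh Ω 𝒯 h ρ) (hΩ : IsPolygonalDomain Ω)
    {K : Set (Eu d)} (hK : K ∈ 𝒯) : interior K ⊆ Ω := by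
  rw [← hΩ.interior_closure]
  exact interior_mono (hT.subset_closure hK)

/-- Integrals over `Ω` split into integrals over the elements. -/
theorem setIntegral_eq_sum (hT : IsQuasiUniformMesh Ω 𝒯 h ρ) (hΩ : IsPolygonalDomain Ω)
    {f : Eu d → ℝ} (hf : IntegrableOn f Ω) :
    ∫ x in Ω, f x = ∑ K ∈ 𝒯, ∫ x in interior K, f x := by
  have h1 : (⋃ K ∈ 𝒯, interior K) =ᵐ[volume] Ω := by
    have h2 := (ae_restrict_iff' hΩ.isOpen.measurableSet).1 (hT.ae_mem_interior hΩ.isOpen)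
    refine Filter.eventuallyEq_set.2 ?_
    filter_upwards [h2] with x hx
    simp only [mem_iUnion, exists_prop]
    exact ⟨fun ⟨K, hK, hxK⟩ => hT.interior_subset hΩ hK hxK, hx⟩
  rw [← setIntegral_congr_set h1]
  exact integral_biUnion_finset 𝒯 (fun K _ => isOpen_interior.measurableSet)
    (fun K hK K' hK' hne => hT.disjoint K hK K' hK' hne)
    (fun K hK => hf.mono_set (hT.interior_subset hΩ hK))

end IsQuasiUniformMesh

theorem eventuallyEq_of_mem_interior {K : Set (Eu d)} {φ f : Eu d → ℝ} (hf : EqOn φ f K)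
    {x : Eu d} (hx : x ∈ interior K) : φ =ᶠ[nhds x] f :=
  hf.eventuallyEq_of_mem (mem_interior_iff_mem_nhds.1 hx)

/-- Finite element functions are square-integrable, with square-integrable derivative. -/
theorem SobReg.of_mem_feSpace (hT : IsQuasiUniformMesh Ω 𝒯 h ρ) (hΩ : IsOpen Ω) {r : ℕ}
    {φ : Eu d → ℝ} (hφ : φ ∈ feSpace Ω 𝒯 r) : SobReg Ω φ := by
  have := hT.isFiniteMeasure
  obtain ⟨hc, hp⟩ := hφ
  refine ⟨?_, ?_, ?_⟩
  · obtain ⟨C, hC⟩ := hT.isCompact_closure.exists_bound_of_continuousOn hc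
    refine MemLp.of_bound ((hc.mono subset_closure).aestronglyMeasurable hΩ.measurableSet) C ?_
    filter_upwards [ae_restrict_mem hΩ.measurableSet] with x hx
    exact hC x (subset_closure hx)
  · filter_upwards [hT.ae_mem_interior hΩ] with x ⟨K, hK, hx⟩
    obtain ⟨f, hf, hfφ⟩ := isPolyOn_iff.1 (hp K hK)
    exact (eventuallyEq_of_mem_interior hfφ hx).differentiableAt_iff.2
      (differentiable_of_mem_polySpace hf x)
  -- The bound is stated for all sets, with default `0` off the mesh, so that `choose` gives a plain
  -- function. Non-negativity makes its sum over the mesh a common bound.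
  · have hb : ∀ K : Set (Eu d), ∃ c : ℝ, 0 ≤ c ∧
        (K ∈ 𝒯 → ∀ x ∈ interior K, ‖fderiv ℝ φ x‖ ≤ c) := by
      intro K
      by_cases hK : K ∈ 𝒯
      · obtain ⟨f, hf, hfφ⟩ := isPolyOn_iff.1 (hp K hK)
        obtain ⟨C, hC⟩ := (hT.isCompact hK).exists_bound_of_continuousOn
          (continuous_fderiv_of_mem_polySpace hf).continuousOn
        refine ⟨max C 0, le_max_right _ _, fun _ x hx => ?_⟩
        rw [(eventuallyEq_of_mem_interior hfφ hx).fderiv_eq]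
        exact (hC x (interior_subset hx)).trans (le_max_left _ _)
      · exact ⟨0, le_rfl, fun h => absurd h hK⟩
    choose c hc0 hc using hb
    refine MemLp.of_bound (measurable_fderiv ℝ φ).aestronglyMeasurable (∑ K ∈ 𝒯, c K) ?_
    filter_upwards [hT.ae_mem_interior hΩ] with x ⟨K, hK, hx⟩
    exact (hc K hK x hx).trans (Finset.single_le_sum (fun K _ => hc0 K) hK)

theorem SobReg.of_mem_dispSpace (hT : IsQuasiUniformMesh Ω 𝒯 h ρ) (hΩ : IsOpen Ω) {r : ℕ}
    {u : Eu d → Eu d} (hu : u ∈ dispSpace Ω 𝒯 r) : SobReg Ω u :=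
  SobReg.of_components fun i => SobReg.of_mem_feSpace hT hΩ (hu.1 i)

theorem norm_gradient (φ : Eu d → ℝ) (x : Eu d) : ‖gradient φ x‖ = ‖fderiv ℝ φ x‖ := by
  simp [gradient]

theorem gradNsq_eq (φ : Eu d → ℝ) : gradNsq Ω φ = ∫ x in Ω, ‖fderiv ℝ φ x‖ ^ 2 := by
  simp only [gradNsq, ipVec, real_inner_self_eq_norm_sq, norm_gradient]

theorem nsq_eq (φ : Eu d → ℝ) : nsq Ω φ = ∫ x in Ω, φ x ^ 2 := by
  simp only [nsq, ip, sq]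

end Mesh

/-- The inverse estimate for finite element functions of degree at most `r` on meshes that are
quasi-uniform with constant `ρ`. -/
theorem exists_inverse_estimate (d r : ℕ) {ρ : ℝ} (hρ : 0 < ρ) :
    ∃ c : ℝ, 0 ≤ c ∧ ∀ (Ω : Set (Eu d)), IsPolygonalDomain Ω →
      ∀ (𝒯 : Finset (Set (Eu d))) (h : ℝ), 0 < h → IsQuasiUniformMesh Ω 𝒯 h ρ →
      ∀ φ ∈ feSpace Ω 𝒯 r, gradNsq Ω φ ≤ c / h ^ 2 * nsq Ω φ := by
  obtain ⟨c, hc, H⟩ := exists_inverse_estimate_element d r hρ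
  refine ⟨c, hc, fun Ω hΩ 𝒯 h hh hT φ hφ => ?_⟩
  have hreg := SobReg.of_mem_feSpace hT hΩ.isOpen hφ
  rw [gradNsq_eq, nsq_eq, hT.setIntegral_eq_sum hΩ hreg.memLp.integrable_sq,
    hT.setIntegral_eq_sum hΩ
      ((memLp_two_iff_integrable_sq_norm hreg.memLp_fderiv.1).1 hreg.memLp_fderiv),
    Finset.mul_sum]
  refine Finset.sum_le_sum fun K hK => ?_
  obtain ⟨f, hf, hfφ⟩ := isPolyOn_iff.1 (hφ.2 K hK)
  obtain ⟨x₀, hx₀⟩ := hT.ball K hK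
  have hx₀K : x₀ ∈ K := hx₀ (Metric.mem_closedBall_self (by positivity))
  -- The centre of the inscribed ball lies in `K`, so the diameter bound gives a concentric outer
  -- ball.
  have hKh : K ⊆ Metric.closedBall x₀ h := fun x hx =>
    (Metric.dist_le_diam_of_mem (hT.isCompact hK).isBounded hx hx₀K).trans (hT.diam_le K hK)
  have h1 := H K x₀ h hh (hT.isCompact hK) hx₀ hKh f hf
  -- On interiors `φ` agrees with its polynomial near each point, so the derivatives agree too.
  rw [← setIntegral_congr_set (hT.interior_ae_eq hK),
    ← setIntegral_congr_set (hT.interior_ae_eq hK)] at h1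
  rw [setIntegral_congr_fun isOpen_interior.measurableSet (g := fun x => ‖fderiv ℝ f x‖ ^ 2)
      fun x hx => by
        simp only [(eventuallyEq_of_mem_interior hfφ hx).fderiv_eq],
    setIntegral_congr_fun isOpen_interior.measurableSet (f := fun x => φ x ^ 2)
      (g := fun x => f x ^ 2) fun x hx => by
        simp only [hfφ (interior_subset hx)]]
  exact h1

/-! ### Bilinear forms -/

section Forms

variable {d : ℕ} {Ω : Set (Eu d)}

theorem ip_comm (φ ψ : Eu d → ℝ) : ip Ω φ ψ = ip Ω ψ φ := by
  simp only [ip, mul_comm]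

theorem ip_smul_left (c : ℝ) (φ ψ : Eu d → ℝ) : ip Ω (c • φ) ψ = c * ip Ω φ ψ := by
  simp only [ip, Pi.smul_apply, smul_eq_mul, mul_assoc, integral_const_mul]

theorem ip_add_left {φ χ ψ : Eu d → ℝ} (hφ : MemLp φ 2 (volume.restrict Ω))
    (hχ : MemLp χ 2 (volume.restrict Ω)) (hψ : MemLp ψ 2 (volume.restrict Ω)) :
    ip Ω (φ + χ) ψ = ip Ω φ ψ + ip Ω χ ψ := by
  simp only [ip, Pi.add_apply, add_mul]
  exact integral_add (hφ.integrable_mul hψ) (hχ.integrable_mul hψ)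

theorem ip_sub_left {φ χ ψ : Eu d → ℝ} (hφ : MemLp φ 2 (volume.restrict Ω))
    (hχ : MemLp χ 2 (volume.restrict Ω)) (hψ : MemLp ψ 2 (volume.restrict Ω)) :
    ip Ω (φ - χ) ψ = ip Ω φ ψ - ip Ω χ ψ := by
  simp only [ip, Pi.sub_apply, sub_mul]
  exact integral_sub (hφ.integrable_mul hψ) (hχ.integrable_mul hψ)

/-- Expansion of the inner product of a difference with a linear combination. -/
theorem ip_sub_comb {φ χ a b c : Eu d → ℝ} (hφ : MemLp φ 2 (volume.restrict Ω))
    (hχ : MemLp χ 2 (volume.restrict Ω)) (ha : MemLp a 2 (volume.restrict Ω))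
    (hb : MemLp b 2 (volume.restrict Ω)) (hc : MemLp c 2 (volume.restrict Ω)) (r s t : ℝ) :
    ip Ω (φ - χ) (r • a + s • b + t • c) =
      r * (ip Ω φ a - ip Ω χ a) + s * (ip Ω φ b - ip Ω χ b) + t * (ip Ω φ c - ip Ω χ c) := by
  have hφχ := hφ.sub hχ
  rw [ip_comm, ip_add_left ((ha.const_smul r).add (hb.const_smul s)) (hc.const_smul t) hφχ,
    ip_add_left (ha.const_smul r) (hb.const_smul s) hφχ, ip_smul_left, ip_smul_left, ip_smul_left,
    ip_comm a, ip_comm b, ip_comm c, ip_sub_left hφ hχ ha, ip_sub_left hφ hχ hb,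
    ip_sub_left hφ hχ hc]

theorem nsq_smul (c : ℝ) (φ : Eu d → ℝ) : nsq Ω (c • φ) = c ^ 2 * nsq Ω φ := by
  rw [nsq, nsq, ip_smul_left, ip_comm, ip_smul_left]; ring

theorem nsq_sub {φ ψ : Eu d → ℝ} (hφ : MemLp φ 2 (volume.restrict Ω))
    (hψ : MemLp ψ 2 (volume.restrict Ω)) :
    nsq Ω (φ - ψ) = nsq Ω φ - 2 * ip Ω φ ψ + nsq Ω ψ := by
  rw [nsq, ip_sub_left hφ hψ (hφ.sub hψ), ip_comm φ, ip_comm ψ, ip_sub_left hφ hψ hφ,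
    ip_sub_left hφ hψ hψ, ip_comm ψ φ, nsq, nsq]
  ring

theorem nsq_nonneg (φ : Eu d → ℝ) : 0 ≤ nsq Ω φ :=
  integral_nonneg fun _ => mul_self_nonneg _

/-! ### The Dirichlet form of vector fields. -/

theorem frob_comm (A B : Eu d →L[ℝ] Eu d) : frob A B = frob B A := by
  simp only [frob, real_inner_comm]

theorem frob_self_nonneg (A : Eu d →L[ℝ] Eu d) : 0 ≤ frob A A :=
  Finset.sum_nonneg fun _ _ => real_inner_self_nonneg

theorem frob_sub_left (A B D : Eu d →L[ℝ] Eu d) : frob (A - B) D = frob A D - frob B D := by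
  simp [frob, inner_sub_left, Finset.sum_sub_distrib]

theorem frob_smul_left (c : ℝ) (A B : Eu d →L[ℝ] Eu d) : frob (c • A) B = c * frob A B := by
  simp [frob, inner_smul_left, Finset.mul_sum]

theorem integrable_inner_of_memLp {f g : Eu d → Eu d} (hf : MemLp f 2 (volume.restrict Ω))
    (hg : MemLp g 2 (volume.restrict Ω)) :
    Integrable (fun x => inner ℝ (f x) (g x)) (volume.restrict Ω) :=
  (hf.norm.integrable_mul hg.norm).mono' (hf.1.inner hg.1)
    (ae_of_all _ fun _ => norm_inner_le_norm _ _)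

theorem integrable_frob {A B : Eu d → (Eu d →L[ℝ] Eu d)} (hA : MemLp A 2 (volume.restrict Ω))
    (hB : MemLp B 2 (volume.restrict Ω)) :
    Integrable (fun x => frob (A x) (B x)) (volume.restrict Ω) := by
  refine integrable_finsetSum _ fun i _ => ?_
  have h1 : ∀ {A : Eu d → (Eu d →L[ℝ] Eu d)}, MemLp A 2 (volume.restrict Ω) →
      MemLp (fun x => A x (unit i)) 2 (volume.restrict Ω) := fun hA =>
    (ContinuousLinearMap.apply ℝ (Eu d) (unit i : Eu d)).comp_memLp' hA
  exact integrable_inner_of_memLp (h1 hA) (h1 hB)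

/-- The form `(∇u, ∇v)`. -/
def gradForm (Ω : Set (Eu d)) (u v : Eu d → Eu d) : ℝ := ipMat Ω (fderiv ℝ u) (fderiv ℝ v)

theorem gradForm_comm (u v : Eu d → Eu d) : gradForm Ω u v = gradForm Ω v u := by
  simp only [gradForm, ipMat, frob_comm]

theorem gradForm_sub_left {u v w : Eu d → Eu d} (hu : SobReg Ω u) (hv : SobReg Ω v)
    (hw : SobReg Ω w) : gradForm Ω (u - v) w = gradForm Ω u w - gradForm Ω v w := by
  simp only [gradForm, ipMat]
  rw [← integral_sub (integrable_frob hu.memLp_fderiv hw.memLp_fderiv)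
    (integrable_frob hv.memLp_fderiv hw.memLp_fderiv)]
  refine integral_congr_ae ?_
  filter_upwards [hu.fderiv_sub_ae hv] with x hx
  rw [hx, Pi.sub_apply, frob_sub_left]

theorem gradForm_smul_left {u : Eu d → Eu d} (hu : SobReg Ω u) (c : ℝ) (w : Eu d → Eu d) :
    gradForm Ω (c • u) w = c * gradForm Ω u w := by
  simp only [gradForm, ipMat]
  rw [← integral_const_mul]
  refine integral_congr_ae ?_
  filter_upwards [hu.fderiv_smul_ae c] with x hx
  rw [hx, Pi.smul_apply, frob_smul_left]

theorem jacNsq_eq (u : Eu d → Eu d) : jacNsq Ω u = gradForm Ω u u := rfl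

theorem jacNsq_nonneg (u : Eu d → Eu d) : 0 ≤ jacNsq Ω u :=
  integral_nonneg fun _ => frob_self_nonneg _

theorem jacNsq_sub {u v : Eu d → Eu d} (hu : SobReg Ω u) (hv : SobReg Ω v) :
    jacNsq Ω (u - v) = jacNsq Ω u - 2 * gradForm Ω u v + jacNsq Ω v := by
  simp only [jacNsq_eq]
  rw [gradForm_sub_left hu hv (hu.sub hv), gradForm_comm u, gradForm_comm v,
    gradForm_sub_left hu hv hu, gradForm_sub_left hu hv hv, gradForm_comm v u]
  ring

theorem jacNsq_smul {u : Eu d → Eu d} (hu : SobReg Ω u) (c : ℝ) :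
    jacNsq Ω (c • u) = c ^ 2 * jacNsq Ω u := by
  simp only [jacNsq_eq]
  rw [gradForm_smul_left hu, gradForm_comm, gradForm_smul_left hu]; ring

/-- The quadratic `t ↦ ‖∇(u - t v)‖²` is non-negative, so its discriminant is not positive. -/
theorem gradForm_le {u v : Eu d → Eu d} (hu : SobReg Ω u) (hv : SobReg Ω v) :
    gradForm Ω u v ≤ √(jacNsq Ω u) * √(jacNsq Ω v) := by
  have h : ∀ t : ℝ, 0 ≤ jacNsq Ω v * (t * t) + (-2 * gradForm Ω u v) * t + jacNsq Ω u := by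
    intro t
    have h1 := jacNsq_nonneg (Ω := Ω) (u - t • v)
    rw [jacNsq_sub hu (hv.smul t), jacNsq_smul hv, gradForm_comm, gradForm_smul_left hv,
      gradForm_comm] at h1
    linarith
  have h2 := discrim_le_zero h
  rw [discrim] at h2
  rw [← Real.sqrt_mul (jacNsq_nonneg u)]
  exact Real.le_sqrt_of_sq_le (by linarith)

theorem memLp_div {u : Eu d → Eu d} (hu : SobReg Ω u) : MemLp (div u) 2 (volume.restrict Ω) := by
  refine memLp_finsetSum _ fun i _ => ?_
  exact ((EuclideanSpace.proj i : Eu d →L[ℝ] ℝ) ∘L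
    ContinuousLinearMap.apply ℝ (Eu d) (unit i : Eu d)).comp_memLp' hu.memLp_fderiv

theorem sqrt_jacNsq_le_h1norm (u : Eu d → Eu d) : √(jacNsq Ω u) ≤ h1norm Ω u :=
  Real.sqrt_le_sqrt (le_add_of_nonneg_left (integral_nonneg fun _ => real_inner_self_nonneg))

/-! ### Scalar gradients and lower bounds for the diffusion forms. -/

theorem aestronglyMeasurable_gradient (φ : Eu d → ℝ) :
    AEStronglyMeasurable (gradient φ) (volume.restrict Ω) :=
  ((InnerProductSpace.toDual ℝ (Eu d)).symm.continuous.measurable.comp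
    (measurable_fderiv ℝ φ)).aestronglyMeasurable

theorem SobReg.memLp_gradient {φ : Eu d → ℝ} (hφ : SobReg Ω φ) :
    MemLp (gradient φ) 2 (volume.restrict Ω) :=
  hφ.memLp_fderiv.of_le (aestronglyMeasurable_gradient φ)
    (ae_of_all _ fun x => (norm_gradient φ x).le)

theorem SobReg.gradient_sub_smul {φ ψ : Eu d → ℝ} (hφ : SobReg Ω φ) (hψ : SobReg Ω ψ) (c : ℝ) :
    ∀ᵐ x ∂(volume.restrict Ω), gradient (φ - c • ψ) x = gradient φ x - c • gradient ψ x := by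
  filter_upwards [hφ.fderiv_sub_ae (hψ.smul c), hψ.fderiv_smul_ae c] with x h1 h2
  simp only [gradient, h1, h2, Pi.sub_apply, Pi.smul_apply, map_sub, map_smul]

theorem integrable_norm_gradient_sq {φ : Eu d → ℝ} (hφ : SobReg Ω φ) :
    Integrable (fun x => ‖gradient φ x‖ ^ 2) (volume.restrict Ω) :=
  (memLp_two_iff_integrable_sq_norm (aestronglyMeasurable_gradient φ)).1 hφ.memLp_gradient

theorem gradNsq_eq_gradient (φ : Eu d → ℝ) : gradNsq Ω φ = ∫ x in Ω, ‖gradient φ x‖ ^ 2 := by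
  simp only [gradNsq, ipVec, real_inner_self_eq_norm_sq]

theorem gradNsq_nonneg (φ : Eu d → ℝ) : 0 ≤ gradNsq Ω φ :=
  integral_nonneg fun _ => real_inner_self_nonneg

/-- Reduces both diffusion estimates to pointwise inequalities between gradients. -/
theorem dissip_le_integral {φ ψ : Eu d → ℝ} (hφ : SobReg Ω φ) (hψ : SobReg Ω ψ) {F : Eu d → ℝ}
    (hF : Integrable F (volume.restrict Ω)) (m b : ℝ)
    (h : ∀ᵐ x ∂(volume.restrict Ω), m * ‖gradient φ x‖ ^ 2 - b * ‖gradient ψ x‖ ^ 2 ≤ F x) :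
    m * gradNsq Ω φ - b * gradNsq Ω ψ ≤ ∫ x in Ω, F x := by
  have h1 := (integrable_norm_gradient_sq hφ).const_mul m
  have h2 := (integrable_norm_gradient_sq hψ).const_mul b
  rw [gradNsq_eq_gradient, gradNsq_eq_gradient, ← integral_const_mul, ← integral_const_mul,
    ← integral_sub h1 h2]
  exact integral_mono_ae (h1.sub h2) hF h

/-- Lower bound for the permeability form with a perturbed first argument. -/
theorem le_permForm {k : ℝ → ℝ} {k_m k_M : ℝ} (hk : IsPermeability k k_m k_M)
    {τ p δ : Eu d → ℝ} (hτ : SobReg Ω τ) (hp : SobReg Ω p) (hδ : SobReg Ω δ) (c : ℝ) :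
    k_m / 2 * gradNsq Ω p - k_M * c ^ 2 / 2 * gradNsq Ω δ ≤ permForm Ω k τ (p - c • δ) p := by
  refine dissip_le_integral hp hδ ?_ _ _ ?_
  · refine Integrable.bdd_mul
      (integrable_inner_of_memLp (hp.sub (hδ.smul c)).memLp_gradient hp.memLp_gradient)
      (hk.continuous.comp_aestronglyMeasurable hτ.memLp.1) (c := k_M) (ae_of_all _ fun x => ?_)
    rw [Real.norm_of_nonneg (hk.pos.trans (hk.lower _)).le]
    exact (hk.upper _).le
  · filter_upwards [hp.gradient_sub_smul hδ c] with x hx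
    rw [hx]
    set a := gradient p x
    set b := gradient δ x
    have h1 : inner ℝ (a - c • b) a = ‖a‖ ^ 2 - c * inner ℝ b a := by
      rw [inner_sub_left, real_inner_self_eq_norm_sq, inner_smul_left]; simp
    -- Young's inequality is applied before `k` is estimated: it gives `k/2 (‖a‖² - c²‖b‖²)`, and
    -- then `k_m` serves the first term and `k_M` the second.
    have h2 : 0 ≤ ‖a‖ ^ 2 - 2 * (c * inner ℝ b a) + c ^ 2 * ‖b‖ ^ 2 := by
      have h3 := norm_sub_sq_real a (c • b)
      rw [inner_smul_right, norm_smul, mul_pow, Real.norm_eq_abs, sq_abs, real_inner_comm] at h3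
      linarith [sq_nonneg ‖a - c • b‖]
    have hl := (hk.lower (τ x)).le
    have hu := (hk.upper (τ x)).le
    have hk0 : 0 ≤ k (τ x) := hk.pos.le.trans hl
    have h4 := mul_nonneg hk0 h2
    have h5 := mul_le_mul_of_nonneg_right hl (sq_nonneg ‖a‖)
    have h6 := mul_le_mul_of_nonneg_right hu (mul_nonneg (sq_nonneg c) (sq_nonneg ‖b‖))
    rw [h1]
    linarith

/-- Both parts follow from positivity of the quadratic form at `a - b` and `a + b`, and symmetry.
The first provides an integrable majorant; the second is Young's inequality in the `Θ`-inner
product. -/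
theorem IsConductivity.abs_dotProduct_le {Θ : Eu d → Matrix (Fin d) (Fin d) ℝ} {θ_m θ_M : ℝ}
    (hΘ : IsConductivity Θ θ_m θ_M) (x a b : Eu d) :
    |a.ofLp ⬝ᵥ (Θ x *ᵥ b.ofLp)| ≤ θ_M / 2 * (‖a‖ ^ 2 + ‖b‖ ^ 2) ∧
      2 * (a.ofLp ⬝ᵥ (Θ x *ᵥ b.ofLp)) ≤
        a.ofLp ⬝ᵥ (Θ x *ᵥ a.ofLp) + b.ofLp ⬝ᵥ (Θ x *ᵥ b.ofLp) := by
  have hs : b.ofLp ⬝ᵥ (Θ x *ᵥ a.ofLp) = a.ofLp ⬝ᵥ (Θ x *ᵥ b.ofLp) := by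
    rw [Matrix.dotProduct_mulVec, ← Matrix.mulVec_transpose, hΘ.symm, dotProduct_comm]
  have h0 : ∀ z : Eu d, 0 ≤ z.ofLp ⬝ᵥ (Θ x *ᵥ z.ofLp) := fun z =>
    (mul_nonneg hΘ.pos.le (sq_nonneg _)).trans (hΘ.lower x z)
  have h1 := h0 (a - b)
  have h2 := h0 (a + b)
  simp only [WithLp.ofLp_sub, WithLp.ofLp_add, Matrix.mulVec_sub, Matrix.mulVec_add,
    dotProduct_sub, sub_dotProduct, dotProduct_add, add_dotProduct, hs] at h1 h2
  have h3 := hΘ.upper x a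
  have h4 := hΘ.upper x b
  exact ⟨abs_le.2 ⟨by linarith, by linarith⟩, by linarith⟩

/-- Lower bound for the heat conduction form with a perturbed first argument. -/
theorem le_heatForm {Θ : Eu d → Matrix (Fin d) (Fin d) ℝ} {θ_m θ_M : ℝ}
    (hΘ : IsConductivity Θ θ_m θ_M) {p δ : Eu d → ℝ} (hp : SobReg Ω p) (hδ : SobReg Ω δ) (c : ℝ) :
    θ_m / 2 * gradNsq Ω p - θ_M * c ^ 2 / 2 * gradNsq Ω δ ≤ heatForm Ω Θ (p - c • δ) p := by
  have hw := hp.sub (hδ.smul c)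
  refine dissip_le_integral hp hδ ?_ _ _ ?_
  · refine Integrable.mono'
      (((integrable_norm_gradient_sq hp).add (integrable_norm_gradient_sq hw)).const_mul (θ_M / 2))
      ?_ (ae_of_all _ fun x => (hΘ.abs_dotProduct_le x _ _).1)
    have hg : ∀ (φ : Eu d → ℝ) (i : Fin d), Measurable fun x => gradient φ x i := fun φ i =>
      (EuclideanSpace.proj i : Eu d →L[ℝ] ℝ).continuous.measurable.comp
        ((InnerProductSpace.toDual ℝ (Eu d)).symm.continuous.measurable.comp
          (measurable_fderiv ℝ φ))
    simp only [dotProduct, Matrix.mulVec]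
    exact (Finset.measurable_sum _ fun i _ => (hg p i).mul
      (Finset.measurable_sum _ fun j _ =>
        (hΘ.measurable i j).mul (hg _ j))).aestronglyMeasurable
  · filter_upwards [hp.gradient_sub_smul hδ c] with x hx
    rw [hx]
    set a := gradient p x
    set b := gradient δ x
    have h1 := (hΘ.abs_dotProduct_le x a (c • b)).2
    have h2 := hΘ.lower x a
    have h3 := hΘ.upper x (c • b)
    rw [norm_smul, mul_pow, Real.norm_eq_abs, sq_abs] at h3
    simp only [WithLp.ofLp_sub, Matrix.mulVec_sub, dotProduct_sub]
    linarith

end Forms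

/-! ### The energy law of the decoupled algorithm -/

/-- The discrete inf-sup condition bounds any `φ ∈ M_h` that is represented by a displacement
gradient. -/
theorem DiscreteInfSup.sq_mul_nsq_le {d : ℕ} {Ω : Set (Eu d)} {𝒯 : Finset (Set (Eu d))}
    {i j : ℕ} {β₁ : ℝ} (hβ₁ : 0 < β₁) (H : DiscreteInfSup Ω 𝒯 i j β₁)
    (hV : ∀ v ∈ dispSpace Ω 𝒯 i, SobReg Ω v) (hne : (dispSpace Ω 𝒯 i).Nonempty)
    {φ : Eu d → ℝ} (hφ : φ ∈ feSpace Ω 𝒯 j) {w : Eu d → Eu d} (hw : SobReg Ω w) {μ : ℝ}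
    (hμ : 0 ≤ μ) (h : ∀ v ∈ dispSpace Ω 𝒯 i, ip Ω (div v) φ = μ * gradForm Ω w v) :
    β₁ ^ 2 * nsq Ω φ ≤ μ ^ 2 * jacNsq Ω w := by
  have : Nonempty (dispSpace Ω 𝒯 i) := hne.to_subtype
  have h1 : β₁ * √(nsq Ω φ) ≤ μ * √(jacNsq Ω w) := by
    refine (H φ hφ).trans (ciSup_le fun v => ?_)
    -- This form of the division bound also covers a vanishing `h1norm`, where the quotient is `0`.
    refine div_le_of_le_mul₀ (Real.sqrt_nonneg _) (by positivity) ?_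
    rw [h v.1 v.2, mul_assoc]
    gcongr
    exact (gradForm_le hw (hV v.1 v.2)).trans (by gcongr; exact sqrt_jacNsq_le_h1norm _)
  have h2 := pow_le_pow_left₀ (by positivity) h1 2
  rwa [mul_pow, mul_pow, Real.sq_sqrt (nsq_nonneg _), Real.sq_sqrt (jacNsq_nonneg _)] at h2

theorem bdiff_succ {F : Type*} [AddCommGroup F] [Module ℝ F] (Δt : ℝ) (v : ℕ → F) (n : ℕ) :
    bdiff Δt v (n + 1) = Δt⁻¹ • (v (n + 1) - v n) := rfl

/-- The summand of the dissipation. -/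
def dissipationTerm {d : ℕ} (P : Coeffs) (Ω : Set (Eu d)) (k_m θ_m : ℝ) (D : Data d) (Δt : ℝ)
    (S : Trajectory d) (n : ℕ) : ℝ :=
  P.μ / 4 * Δt * jacNsq Ω (bdiff Δt S.u (n + 1))
    + k_m / 2 * gradNsq Ω (S.p (n + 1)) + θ_m / 2 * gradNsq Ω (S.T (n + 1))
    + (P.γ₂ + P.γ₅) * Δt / 2 * nsq Ω (bdiff Δt S.ϖ n)
    + (P.γ₂ + P.γ₃) * Δt / 2 * nsq Ω (bdiff Δt S.ς n)
    - P.γ₂ * Δt / 2 * nsq Ω (bdiff Δt S.ς n - bdiff Δt S.ϖ n)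
    + P.γ₆ * Δt / 2 * nsq Ω (bdiff Δt S.τ (n + 1))
    - ip Ω D.g (S.p (n + 1)) - bip Ω D.g₁ (S.p (n + 1))
    - ip Ω D.ϕ (S.T (n + 1)) - bip Ω D.ϕ₁ (S.T (n + 1))

theorem dissipation_succ {d : ℕ} (P : Coeffs) (Ω : Set (Eu d)) (k_m θ_m : ℝ) (D : Data d)
    (Δt : ℝ) (S : Trajectory d) (l : ℕ) :
    dissipation P Ω k_m θ_m D Δt S (l + 1) =
      dissipation P Ω k_m θ_m D Δt S l + Δt * dissipationTerm P Ω k_m θ_m D Δt S (l + 1) := by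
  rw [dissipation, Finset.sum_Icc_succ_top (by omega), mul_add]
  rfl

section Step

variable {d : ℕ} {P : Coeffs} {Ω : Set (Eu d)} {𝒯 : Finset (Set (Eu d))}
  {k_m k_M θ_m θ_M β₁ : ℝ} {i j : ℕ} {W : Submodule ℝ (Eu d → ℝ)} {k : ℝ → ℝ} {Θ : Eu d → Matrix (Fin d) (Fin d) ℝ}
  {D : Data d} {Δt : ℝ} {N : ℕ} {S : Trajectory d}

namespace IsMFEA

variable {V : Set (Eu d → Eu d)} {M : Submodule ℝ (Eu d → ℝ)} {θ : ℕ}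

/-- Level `0` is separate: the initial values contain `div (S.u 0)`, which may jump across faces, so
they need not lie in `W`. Square-integrability suffices, since their gradients never enter. -/
theorem memLp_ϖ_ς (hS : IsMFEA θ P Ω k Θ D V M W Δt N S) (hV : ∀ v ∈ V, SobReg Ω v)
    (hW : ∀ ψ ∈ W, SobReg Ω ψ) {n : ℕ} (hn : n ≤ N) :
    MemLp (S.ϖ n) 2 (volume.restrict Ω) ∧ MemLp (S.ς n) 2 (volume.restrict Ω) := by
  cases n with
  | zero =>
    have hp := (hW _ hS.p_zero_mem).memLp
    have hT := (hW _ hS.T_zero_mem).memLp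
    have hq : MemLp (S.q 0) 2 (volume.restrict Ω) := by
      rw [hS.q_zero]; exact memLp_div (hV _ hS.u_zero_mem)
    rw [hS.ϖ_zero, hS.ς_zero]
    exact ⟨((hp.const_smul _).sub (hT.const_smul _)).add (hq.const_smul _),
      ((hT.const_smul _).sub (hp.const_smul _)).add (hq.const_smul _)⟩
  | succ m => exact ⟨(hW _ (hS.ϖ_mem m hn)).memLp, (hW _ (hS.ς_mem m hn)).memLp⟩

/-- Control of the increment of `τ` by the increment of `u`. -/
theorem gradNsq_τ_sub_le (hS : IsMFEA θ P Ω k Θ D (dispSpace Ω 𝒯 i) (feSpace Ω 𝒯 j) W Δt N S)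
    (hμ : 0 ≤ P.μ) (hV : ∀ v ∈ dispSpace Ω 𝒯 i, SobReg Ω v)
    (hM : ∀ φ ∈ feSpace Ω 𝒯 j, SobReg Ω φ) (hβ₁ : 0 < β₁) (hIS : DiscreteInfSup Ω 𝒯 i j β₁)
    {c : ℝ} (hc : 0 ≤ c) (hinv : ∀ φ ∈ feSpace Ω 𝒯 j, gradNsq Ω φ ≤ c * nsq Ω φ)
    {m : ℕ} (hm : m + 2 ≤ N) :
    gradNsq Ω (S.τ (m + 2) - S.τ (m + 1)) ≤
      c * (P.μ ^ 2 / β₁ ^ 2) * jacNsq Ω (S.u (m + 2) - S.u (m + 1)) := by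
  have hτ2 := hS.τ_mem (m + 1) hm
  have hτ1 := hS.τ_mem m (by omega)
  have hu2 := hV _ (hS.u_mem (m + 1) hm)
  have hu1 := hV _ (hS.u_mem m (by omega))
  have h1 : β₁ ^ 2 * nsq Ω (S.τ (m + 2) - S.τ (m + 1)) ≤
      P.μ ^ 2 * jacNsq Ω (S.u (m + 2) - S.u (m + 1)) := by
    refine hIS.sq_mul_nsq_le hβ₁ hV ⟨_, hS.u_zero_mem⟩ (sub_mem hτ2 hτ1) (hu2.sub hu1) hμ
      fun v hv => ?_
    -- The loads do not depend on time and cancel in the difference. Both levels are at least `1`,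
    -- as the momentum equation is not imposed on the initial values.
    have e1 := hS.momentum (m + 1) hm v hv
    have e2 := hS.momentum m (by omega) v hv
    rw [← gradForm] at e1 e2
    rw [gradForm_sub_left hu2 hu1 (hV v hv), ip_comm,
      ip_sub_left (hM _ hτ2).memLp (hM _ hτ1).memLp (memLp_div (hV v hv))]
    linarith
  refine (hinv _ (sub_mem hτ2 hτ1)).trans ?_
  rw [mul_assoc]
  gcongr
  rw [div_mul_eq_mul_div, le_div_iff₀ (by positivity)]
  linarith

/-- One step of the energy law. -/
theorem energy_step (hS : IsMFEA 0 P Ω k Θ D V M W Δt N S)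
    (hV : ∀ v ∈ V, SobReg Ω v) (hMW : M ≤ W) (hW : ∀ ψ ∈ W, SobReg Ω ψ) (hΔt : 0 < Δt)
    (hk : IsPermeability k k_m k_M) (hΘ : IsConductivity Θ θ_m θ_M) {m : ℕ} (hm : m + 2 ≤ N)
    (hτ : Δt * ((k_M * P.γ₄ ^ 2 + θ_M * P.γ₁ ^ 2) / 2 *
      gradNsq Ω (S.τ (m + 2) - S.τ (m + 1))) ≤
        P.μ / 4 * jacNsq Ω (S.u (m + 2) - S.u (m + 1))) :
    energy 0 P Ω D S (m + 1) + Δt * dissipationTerm P Ω k_m θ_m D Δt S (m + 1) ≤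
      energy 0 P Ω D S m := by
  have hm1 : m + 1 < N := hm
  have hm0 : m < N := by omega
  have mu2 := hS.u_mem (m + 1) hm1
  have mu1 := hS.u_mem m hm0
  have hu2 := hV _ mu2
  have hu1 := hV _ mu1
  have hdu2 := memLp_div hu2
  have hdu1 := memLp_div hu1
  have mτ2 := hS.τ_mem (m + 1) hm1
  have rτ2 := hW _ (hMW mτ2)
  have rτ1 := hW _ (hMW (hS.τ_mem m hm0))
  have hτ2 := rτ2.memLp
  have hτ1 := rτ1.memLp
  obtain ⟨hϖ1, hς1⟩ := hS.memLp_ϖ_ς hV hW (n := m + 1) (by omega)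
  obtain ⟨hϖ0, hς0⟩ := hS.memLp_ϖ_ς hV hW (n := m) (by omega)
  have ep : S.p (m + 2) = P.γ₄ • S.τ (m + 2) + P.γ₅ • S.ϖ (m + 1) + P.γ₂ • S.ς (m + 1) :=
    hS.p_step (m + 1) hm1
  have eT : S.T (m + 2) = P.γ₁ • S.τ (m + 2) + P.γ₂ • S.ϖ (m + 1) + P.γ₃ • S.ς (m + 1) :=
    hS.T_step (m + 1) hm1
  -- Admissible as a test function because it is built from `ϖ` and `ς` at level `m + 1 ≥ 1`.
  have mp : S.p (m + 2) ∈ W := by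
    rw [ep]
    exact add_mem (add_mem (W.smul_mem _ (hMW mτ2)) (W.smul_mem _ (hS.ϖ_mem m hm0)))
      (W.smul_mem _ (hS.ς_mem m hm0))
  have mT : S.T (m + 2) ∈ W := by
    rw [eT]
    exact add_mem (add_mem (W.smul_mem _ (hMW mτ2)) (W.smul_mem _ (hS.ϖ_mem m hm0)))
      (W.smul_mem _ (hS.ς_mem m hm0))
  -- The time lag: the diffused quantity of level `m + 1` differs from the test function by a
  -- multiple of the increment of `τ`.
  have ep' : P.γ₄ • S.τ (m + 1) + P.γ₅ • S.ϖ (m + 1) + P.γ₂ • S.ς (m + 1) =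
      S.p (m + 2) - P.γ₄ • (S.τ (m + 2) - S.τ (m + 1)) := by
    rw [ep, smul_sub]; abel
  have eT' : P.γ₁ • S.τ (m + 1) + P.γ₂ • S.ϖ (m + 1) + P.γ₃ • S.ς (m + 1) =
      S.T (m + 2) - P.γ₁ • (S.τ (m + 2) - S.τ (m + 1)) := by
    rw [eT, smul_sub]; abel
  have M2 : P.μ * gradForm Ω (S.u (m + 2)) (S.u (m + 2)) - ip Ω (S.τ (m + 2)) (div (S.u (m + 2))) =
      ipVec Ω D.f (S.u (m + 2)) + bipVec Ω D.f₁ (S.u (m + 2)) := hS.momentum (m + 1) hm1 _ mu2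
  have M1 : P.μ * gradForm Ω (S.u (m + 2)) (S.u (m + 1)) - ip Ω (S.τ (m + 2)) (div (S.u (m + 1))) =
      ipVec Ω D.f (S.u (m + 1)) + bipVec Ω D.f₁ (S.u (m + 1)) := hS.momentum (m + 1) hm1 _ mu1
  have C2 : P.γ₆ * ip Ω (S.τ (m + 2)) (S.τ (m + 2)) + ip Ω (div (S.u (m + 2))) (S.τ (m + 2)) =
      P.γ₄ * ip Ω (S.ϖ (m + 1)) (S.τ (m + 2)) + P.γ₁ * ip Ω (S.ς (m + 1)) (S.τ (m + 2)) :=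
    hS.constraint (m + 1) hm1 _ mτ2
  -- The older constraint is tested with the newer `τ`, so that subtraction produces increments
  -- paired with `S.τ (m + 2)`.
  have C1 : P.γ₆ * ip Ω (S.τ (m + 1)) (S.τ (m + 2)) + ip Ω (div (S.u (m + 1))) (S.τ (m + 2)) =
      P.γ₄ * ip Ω (S.ϖ m) (S.τ (m + 2)) + P.γ₁ * ip Ω (S.ς m) (S.τ (m + 2)) :=
    hS.constraint m hm0 _ mτ2
  -- Index `m` is the equation at level `m + 1`; its test function carries `τ` one level later.
  have E1 := hS.mass m hm0 _ mp
  have E2 := hS.heat m hm0 _ mT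
  have L1 := le_permForm hk rτ1 (hW _ mp) (rτ2.sub rτ1) P.γ₄
  have L2 := le_heatForm hΘ (hW _ mT) (rτ2.sub rτ1) P.γ₁
  rw [ep', bdiff_succ, ip_smul_left] at E1
  rw [eT', bdiff_succ, ip_smul_left] at E2
  have X1 := ip_sub_comb hϖ1 hϖ0 hτ2 hϖ1 hς1 P.γ₄ P.γ₅ P.γ₂
  have X2 := ip_sub_comb hς1 hς0 hτ2 hϖ1 hς1 P.γ₁ P.γ₂ P.γ₃
  rw [← ep] at X1
  rw [← eT] at X2
  have E1' := congrArg (Δt * ·) E1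
  have E2' := congrArg (Δt * ·) E2
  simp only [mul_add, mul_inv_cancel_left₀ hΔt.ne'] at E1' E2'
  have L1' := mul_le_mul_of_nonneg_left L1 hΔt.le
  have L2' := mul_le_mul_of_nonneg_left L2 hΔt.le
  have Y1 := nsq_sub (Ω := Ω) hς1 hϖ1
  have Y0 := nsq_sub (Ω := Ω) hς0 hϖ0
  have Yϖ := nsq_sub (Ω := Ω) hϖ1 hϖ0
  have Yς := nsq_sub (Ω := Ω) hς1 hς0
  have Yτ := nsq_sub (Ω := Ω) hτ2 hτ1
  have Yd := nsq_sub (Ω := Ω) (hς1.sub hς0) (hϖ1.sub hϖ0)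
  have Yu := jacNsq_sub (Ω := Ω) hu2 hu1
  rw [ip_sub_left hς1 hς0 (hϖ1.sub hϖ0), ip_comm (S.ς (m + 1)) (S.ϖ (m + 1) - _),
    ip_comm (S.ς m) (S.ϖ (m + 1) - _), ip_sub_left hϖ1 hϖ0 hς1, ip_sub_left hϖ1 hϖ0 hς0,
    Yϖ, Yς] at Yd
  have hsq : Δt * Δt * Δt⁻¹ ^ 2 = 1 := by field_simp
  have hdiss : Δt * dissipationTerm P Ω k_m θ_m D Δt S (m + 1) =
      P.μ / 4 * jacNsq Ω (S.u (m + 2) - S.u (m + 1))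
      + Δt * (k_m / 2 * gradNsq Ω (S.p (m + 2)) + θ_m / 2 * gradNsq Ω (S.T (m + 2)))
      + (P.γ₂ + P.γ₅) / 2 * nsq Ω (S.ϖ (m + 1) - S.ϖ m)
      + (P.γ₂ + P.γ₃) / 2 * nsq Ω (S.ς (m + 1) - S.ς m)
      - P.γ₂ / 2 * nsq Ω (S.ς (m + 1) - S.ς m - (S.ϖ (m + 1) - S.ϖ m))
      + P.γ₆ / 2 * nsq Ω (S.τ (m + 2) - S.τ (m + 1))
      - Δt * (ip Ω D.g (S.p (m + 2)) + bip Ω D.g₁ (S.p (m + 2))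
        + ip Ω D.ϕ (S.T (m + 2)) + bip Ω D.ϕ₁ (S.T (m + 2))) := by
    simp only [dissipationTerm, bdiff_succ, ← smul_sub, nsq_smul, jacNsq_smul (hu2.sub hu1),
      show m + 1 + 1 = m + 2 from rfl]
    linear_combination (P.μ / 4 * jacNsq Ω (S.u (m + 2) - S.u (m + 1))
      + (P.γ₂ + P.γ₅) / 2 * nsq Ω (S.ϖ (m + 1) - S.ϖ m)
      + (P.γ₂ + P.γ₃) / 2 * nsq Ω (S.ς (m + 1) - S.ς m)
      - P.γ₂ / 2 * nsq Ω (S.ς (m + 1) - S.ς m - (S.ϖ (m + 1) - S.ϖ m))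
      + P.γ₆ / 2 * nsq Ω (S.τ (m + 2) - S.τ (m + 1))) * hsq
  rw [Yu] at hτ
  -- Every square of an increment is expanded into inner products; after `ip_comm` fixes their
  -- order, the claim is linear in them.
  rw [hdiss, Yd, Yϖ, Yς, Yτ, Yu]
  simp only [energy, add_zero, show m + 1 + 1 = m + 2 from rfl]
  rw [Y1, Y0]
  rw [ip_comm (div (S.u (m + 2)))] at C2
  rw [ip_comm (div (S.u (m + 1))), ip_comm (S.τ (m + 1))] at C1
  rw [ip_comm (S.ϖ m) (S.ϖ (m + 1))] at X1
  rw [ip_comm (S.ς (m + 1)) (S.ϖ (m + 1)), ip_comm (S.ς m) (S.ϖ (m + 1)),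
    ip_comm (S.ς m) (S.ς (m + 1))] at X2
  rw [ip_comm (S.ς (m + 1)) (S.ϖ (m + 1)), ip_comm (S.ς m) (S.ϖ m)]
  simp only [nsq, jacNsq_eq] at hτ ⊢
  linarith

end IsMFEA

end Step

end ThermoPoro

end

/-! ### Choice of the constant and telescoping. -/

theorem mainTheorem5 (d : ℕ) (hd : d = 2 ∨ d = 3) (P : Coeffs) (hP : P.Admissible)
    (k_M θ_M β₁ ρ : ℝ) (hβ₁ : 0 < β₁) (hρ : 0 < ρ) (j : ℕ) :
    ∃ C : ℝ, 0 < C ∧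
      ∀ (Ω : Set (Eu d)), IsPolygonalDomain Ω →
      ∀ (𝒯 : Finset (Set (Eu d))) (h : ℝ), IsQuasiUniformMesh Ω 𝒯 h ρ →
      ∀ (i : ℕ), DiscreteInfSup Ω 𝒯 i j β₁ →
      ∀ (W : Submodule ℝ (Eu d → ℝ)), feSpace Ω 𝒯 j ≤ W → (∃ r, W ≤ feSpace Ω 𝒯 r) →
      ∀ (k : ℝ → ℝ) (k_m : ℝ), IsPermeability k k_m k_M →
      ∀ (Θ : Eu d → Matrix (Fin d) (Fin d) ℝ) (θ_m : ℝ), IsConductivity Θ θ_m θ_M →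
      ∀ (D : Data d), D.Regular Ω →
      ∀ (t_f : ℝ) (N : ℕ), 0 < t_f → 0 < N → t_f / N ≤ C * h ^ 2 →
      ∀ (S : Trajectory d),
        IsMFEA 0 P Ω k Θ D (dispSpace Ω 𝒯 i) (feSpace Ω 𝒯 j) W (t_f / N) N S →
      ∀ l : ℕ, 1 ≤ l → l + 1 ≤ N →
        energy 0 P Ω D S l + dissipation P Ω k_m θ_m D (t_f / N) S l ≤ energy 0 P Ω D S 0 := by
  obtain ⟨c, hc, hinv⟩ := exists_inverse_estimate d j hρ
  -- The constant is fixed before `k` and `Θ`, when `k_M` and `θ_M` have no known sign; hence the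
  -- absolute values.
  set Q : ℝ := (|k_M| * P.γ₄ ^ 2 + |θ_M| * P.γ₁ ^ 2) / 2 * (c * (P.μ ^ 2 / β₁ ^ 2)) with hQ
  have hQ0 : 0 ≤ Q := by positivity
  have hμ := hP.μ_pos
  -- `Q + 1` rather than `Q`, which may vanish.
  refine ⟨P.μ / 4 / (Q + 1), by positivity, ?_⟩
  intro Ω hΩ 𝒯 h hT i hIS W hMW ⟨r, hWr⟩ k k_m hk Θ θ_m hΘ D _ t_f N htf hN hΔ S hS l _ hl
  set Δt := t_f / N
  have hΔt : 0 < Δt := by positivity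
  -- `h` is a diameter, and `h = 0` would force `Δt ≤ 0`.
  have hh : 0 < h := by
    obtain ⟨K, -, hK⟩ := hT.diam_eq
    have h0 : 0 ≤ h := hK ▸ Metric.diam_nonneg
    refine h0.lt_of_ne fun h0 => ?_
    rw [← h0] at hΔ
    norm_num at hΔ
    exact hΔt.not_ge hΔ
  have hV : ∀ v ∈ dispSpace Ω 𝒯 i, SobReg Ω v := fun v hv =>
    SobReg.of_mem_dispSpace hT hΩ.isOpen hv
  have hW : ∀ ψ ∈ W, SobReg Ω ψ := fun ψ hψ => SobReg.of_mem_feSpace hT hΩ.isOpen (hWr hψ)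
  have hΔQ : Δt * Q ≤ P.μ / 4 * h ^ 2 := by
    rw [div_mul_eq_mul_div, le_div_iff₀ (by positivity)] at hΔ
    linarith
  have hstep : ∀ m, m + 2 ≤ N → energy 0 P Ω D S (m + 1) +
      Δt * dissipationTerm P Ω k_m θ_m D Δt S (m + 1) ≤ energy 0 P Ω D S m := by
    intro m hm
    refine hS.energy_step hV hMW hW hΔt hk hΘ hm ?_
    have h1 := hS.gradNsq_τ_sub_le hμ.le hV (fun φ hφ => hW φ (hMW hφ)) hβ₁ hIS
      (c := c / h ^ 2) (by positivity) (hinv Ω hΩ 𝒯 h hh hT) hm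
    set J := jacNsq Ω (S.u (m + 2) - S.u (m + 1))
    have hJ : 0 ≤ J := jacNsq_nonneg _
    calc Δt * ((k_M * P.γ₄ ^ 2 + θ_M * P.γ₁ ^ 2) / 2 *
          gradNsq Ω (S.τ (m + 2) - S.τ (m + 1)))
        ≤ Δt * ((|k_M| * P.γ₄ ^ 2 + |θ_M| * P.γ₁ ^ 2) / 2 *
          (c / h ^ 2 * (P.μ ^ 2 / β₁ ^ 2) * J)) := by
          gcongr
          · exact gradNsq_nonneg _
          · exact le_abs_self _
          · exact le_abs_self _
      _ = Δt * Q / h ^ 2 * J := by rw [hQ]; ring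
      _ ≤ P.μ / 4 * J := by
          refine mul_le_mul_of_nonneg_right ?_ hJ
          rwa [div_le_iff₀ (by positivity)]
  -- Telescoping starts at `l = 0`, where the dissipation is an empty sum.
  have key : ∀ l, l + 1 ≤ N → energy 0 P Ω D S l + dissipation P Ω k_m θ_m D Δt S l ≤
      energy 0 P Ω D S 0 := by
    intro l
    induction l with
    | zero => intro _; simp [dissipation]
    | succ l ih =>
      intro hl
      rw [dissipation_succ]
      linarith [ih (by omega), hstep l (by omega)]
  exact key l hl
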